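/- **Setting.** Let $\mathbb T=\{e\}\cup\bigcup_{n\ge1}\mathbb N^n$ be the Ulam–Harris space with ancestor $e$; $y\preceq x$ ($x$ stems from $y$) means $x=yz$ for some $z\in\mathbb T$. For $x\neq e$ let $mx$ be the mother of $x$ and $rx$ her rank (the last entry of $x$). A *line* is a set $L\subset\mathbb T$ no two distinct members of which are comparable under $\preceq$; it is *covering* if every $x\in\mathbb T$ is comparable with some member of $L$. Write $\Pr L=\{x: y\preceq x\text{ for some }y\in L\}$, and $A\preceq B$ if $B\subseteq \Pr A$. Let $(\mathcal S,\mathscr S)$ (types) and $(\Omega_\ell,\mathscr A_\ell)$ (lives) be measurable spaces, with measurable maps $\tau(k):\Omega_\ell\to[0,\infty]$, $\tau(1)\le\tau(2)\le\cdots$ (mother's age at the birth of her $k$th child; $\infty$ if that child is never born) and $\sigma(k):\Omega_\ell\to\mathcal S$ (the type of the $k$th child), and let $P(s,\cdot)$ be a probability kernel from $\mathcal S$ to $\Omega_\ell$ (the life kernel). On $\Omega=\mathcal S\times\Omega_\ell^{\mathbb T}$, with its product $\sigma$-algebra $\mathscr A$, let $U_x$ be the life of $x$, let $\sigma_e$ be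 the $\mathcal S$-coordinate and $\sigma_x=\sigma(rx)\circ U_{mx}$ the type of $x\ne e$, and let $t_e=0$, $t_x=t_{mx}+\tau(rx)\circ U_{mx}$. Let $\mathbb P_s$ be the population law with life kernel $P$ and ancestor type $s$: $\sigma_e=s$, and lives are drawn successively, mothers before daughters, the life of $x$ having law $P(\sigma_x,\cdot)$ given all lives drawn before. Let $\mathscr R=\{x:t_x<\infty\}$ be the set of realised individuals, $E=\{\mathscr R\text{ is finite}\}$ the event of extinction, $q_s=\mathbb P_s(E)$, and $S_x\omega=(\sigma_x,(U_{xz})_{z\in\mathbb T})$. For a line $L$, let $\mathcal F_L$ be generated by $\sigma_e$ and all $U_x$ with $x\notin\Pr L$; let $\mathcal F_{L\cap\mathscr R}$ consist of those $A\in\mathscr A$ with $A\cap\{L\cap\mathscr R\preceq M\}\in\mathcal F_M$ for all lines $M$; and let $\mathcal F_{\mathscr R}$ be generated by $\sigma_e$ and the events $\{x\in\mathscr R,\,U_x\in C\}$ with $x\in\mathbb T$, $C\in\mathscr A_\ell$ (events pertaining only to realised individuals). **Theorem.** Suppose that $q_s>0$ for all $s\in\mathcal S$. Put $\tilde{\mathbb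 P}_s=\mathbb P_s(\cdot\mid E)$ and $\tilde P(s,A)=\tilde{\mathbb P}_s(\mathcal S\times A\times\Omega_\ell^{\mathbb T\setminus\{e\}})$ for $A\in\mathscr A_\ell$. 1. For every $s$, $\tilde{\mathbb P}_s$ coincides on $\mathcal F_{\mathscr R}$ with the population law, with ancestor type $s$, of the branching process with life kernel $\tilde P$ (and the same $\tau(k)$, $\sigma(k)$). 2. The branching process with life kernel $\tilde P$ has extinction probability one from every starting type. 3. For every $s$, every covering line $L$ and all $A_x\in\mathscr A$ $(x\in L)$, $$\tilde{\mathbb P}_s\Big(\bigcap_{x\in L\cap\mathscr R}S_x^{-1}A_x\,\Big|\,\mathcal F_{L\cap\mathscr R}\Big)=\prod_{x\in L\cap\mathscr R}\tilde{\mathbb P}_{\sigma_x}(A_x)\qquad\tilde{\mathbb P}_s\text{-a.s.},$$ where the intersection over the empty set is $\Omega$ and the empty product is $1$. 4. Let $L$ be a covering line such that, $\mathbb P_s$-a.s., only finitely many realised individuals are not proper descendants of members of $L$. Then, on $\mathcal F_{L\cap\mathscr R}$, $\tilde{\mathbb P}_s\ll\mathbb P_s$ and $$\frac{d\tilde{\mathbb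 P}_s}{d\mathbb P_s}\bigg|_{\mathcal F_{L\cap\mathscr R}}=\frac1{q_s}\prod_{x\in L\cap\mathscr R}q_{\sigma_x}\qquad\mathbb P_s\text{-a.s.}$$ 5. The finiteness condition in 4 holds for every $s$ and every line $L$ that meets every infinite line of descent $e=x_0,x_1,x_2,\dots$ (with $x_n=mx_{n+1}$), provided that every individual a.s. has finitely many children, i.e. $P(r,\#\{k:\tau(k)<\infty\}<\infty)=1$ for all $r\in\mathcal S$. -/

import Mathlib

open MeasureTheory ProbabilityTheory Set
open scoped ENNReal

namespace UlamHarris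

/-- The Ulam-Harris space of possible individuals. A sequence `(x₁, …, xₙ)` is stored with its last
entry first, so that `[]` is the ancestor, `k :: x` is the child of `x` of rank `k` (the ranks are
`0, 1, 2, …`), the mother of `x` is `x.tail`, the concatenation `xz` is the list `z ++ x`,
and `x` stems from `y` iff `y <:+ x`, that is, iff `x = z ++ y` for some `z`. -/
abbrev Individual : Type := List ℕ

/-- The progeny `Pr L` of a set `L` of individuals. -/
def progeny (L : Set Individual) : Set Individual := {x | ∃ y ∈ L, y <:+ x}

/-- `A ≼ B`: every member of `B` stems from some member of `A`. -/
def Precedes (A B : Set Individual) : Prop := ∀ x ∈ B, x ∈ progeny A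

/-- A (stopping) line: no two different members are in direct line of descent. -/
def IsLine (L : Set Individual) : Prop :=
  ∀ x ∈ L, ∀ y ∈ L, x ≠ y → ¬ (x <:+ y ∨ y <:+ x)

/-- A covering line: a line such that every individual is in direct line of descent with one of its
members. -/
def IsCoveringLine (L : Set Individual) : Prop :=
  IsLine L ∧ ∀ x, ∃ y ∈ L, x <:+ y ∨ y <:+ x

/-- The proper descendants of the members of `L`. -/
def properProgeny (L : Set Individual) : Set Individual := {x | ∃ y ∈ L, y <:+ x ∧ y ≠ x}

/-- An infinite line of descent `e = c 0, c 1, c 2, …`, each individual being the mother of the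
next one. -/
def IsInfiniteDescent (c : ℕ → Individual) : Prop :=
  c 0 = [] ∧ ∀ n, ∃ k, c (n + 1) = k :: c n

/-- In the standard numbering of the individuals, mothers precede their daughters. -/
theorem encode_mother_le (n : ℕ) :
    Encodable.encode (Denumerable.ofNat Individual (n + 1)).tail ≤ n := by
  have h : Encodable.encode (Denumerable.ofNat Individual (n + 1)) = n + 1 :=
    Denumerable.encode_ofNat (n + 1)
  cases hx : Denumerable.ofNat Individual (n + 1) with
  | nil => simp
  | cons k x =>
    rw [hx, Encodable.encode_list_cons] at h
    have h2 := Nat.right_le_pair (Encodable.encode k) (Encodable.encode x)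
    simp only [List.tail_cons]
    omega

/-- The population space `S × Ωl ^ T`: the type of the ancestor and the lives of all possible
individuals. -/
abbrev PopulationSpace (S Ωl : Type*) : Type _ := S × (Individual → Ωl)

/-- The σ-algebra `F_L` generated by the type of the ancestor and by the lives of all individuals
that do not stem from `L`. -/
@[reducible] def preLine (S Ωl : Type*) [MeasurableSpace S] [MeasurableSpace Ωl] (L : Set Individual) :
    MeasurableSpace (PopulationSpace S Ωl) :=
  MeasurableSpace.comap Prod.fst inferInstance ⊔
    ⨆ x ∈ (progeny L)ᶜ, MeasurableSpace.comap (fun ω => ω.2 x) inferInstance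

/-- A random line is optional if `{𝓛 ≼ M}` belongs to `F_M` for all lines `M`. -/
def IsOptional {S Ωl : Type*} [MeasurableSpace S] [MeasurableSpace Ωl]
    (𝓛 : PopulationSpace S Ωl → Set Individual) : Prop :=
  (∀ ω, IsLine (𝓛 ω)) ∧
    ∀ M, IsLine M → MeasurableSet[preLine S Ωl M] {ω | Precedes (𝓛 ω) M}

/-- The σ-algebra `F_𝓛` of the events preceding an optional line `𝓛`: the events `A` such that
`A ∩ {𝓛 ≼ M}` belongs to `F_M` for all lines `M`. -/
@[reducible] def IsOptional.sigma {S Ωl : Type*} [MeasurableSpace S] [MeasurableSpace Ωl]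
    {𝓛 : PopulationSpace S Ωl → Set Individual} (h : IsOptional 𝓛) :
    MeasurableSpace (PopulationSpace S Ωl) where
  MeasurableSet' A := MeasurableSet A ∧
    ∀ M, IsLine M → MeasurableSet[preLine S Ωl M] (A ∩ {ω | Precedes (𝓛 ω) M})
  measurableSet_empty := by
    refine ⟨MeasurableSet.empty, fun M _ => ?_⟩
    rw [empty_inter]
    exact @MeasurableSet.empty _ (preLine S Ωl M)
  measurableSet_compl A hA := by
    refine ⟨hA.1.compl, fun M hM => ?_⟩
    have e : Aᶜ ∩ {ω | Precedes (𝓛 ω) M} =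
        {ω | Precedes (𝓛 ω) M} \ (A ∩ {ω | Precedes (𝓛 ω) M}) := by
      ext ω; simp only [mem_inter_iff, mem_compl_iff, mem_sdiff]; tauto
    rw [e]
    exact @MeasurableSet.diff _ (preLine S Ωl M) _ _ (h.2 M hM) (hA.2 M hM)
  measurableSet_iUnion f hf := by
    refine ⟨MeasurableSet.iUnion fun i => (hf i).1, fun M hM => ?_⟩
    rw [iUnion_inter]
    exact @MeasurableSet.iUnion _ _ (preLine S Ωl M) _ _ fun i => (hf i).2 M hM

theorem IsOptional.sigma_le {S Ωl : Type*} [MeasurableSpace S] [MeasurableSpace Ωl]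
    {𝓛 : PopulationSpace S Ωl → Set Individual} (h : IsOptional 𝓛) :
    h.sigma ≤ (inferInstance : MeasurableSpace (PopulationSpace S Ωl)) :=
  fun _ hA => hA.1

end UlamHarris

open UlamHarris

/-- A general multi-type branching process with type space `S` and life space `Ωl`. -/
structure BranchingProcess (S Ωl : Type*) [MeasurableSpace S] [MeasurableSpace Ωl] where
  /-- the mother's age at the birth of her child of rank `k`; the child is never born if it is `∞` -/
  τ : ℕ → Ωl → ℝ≥0∞
  measurable_τ : ∀ k, Measurable (τ k)
  monotone_τ : ∀ w, Monotone fun k => τ k w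
  /-- the type of the child of rank `k` -/
  σ : ℕ → Ωl → S
  measurable_σ : ∀ k, Measurable (σ k)
  /-- the life kernel: `life s` is the law of the life of an individual of type `s` -/
  life : Kernel S Ωl
  isMarkovKernel_life : IsMarkovKernel life

namespace BranchingProcess

variable {S Ωl : Type*} [MeasurableSpace S] [MeasurableSpace Ωl] (B : BranchingProcess S Ωl)

/-- The type `σ_x` of the individual `x`. -/
def typeOf : Individual → PopulationSpace S Ωl → S
  | [], ω => ω.1
  | k :: x, ω => B.σ k (ω.2 x)

/-- The birth time `t_x` of the individual `x`. -/
noncomputable def birthTime : Individual → PopulationSpace S Ωl → ℝ≥0∞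
  | [], _ => 0
  | k :: x, ω => birthTime x ω + B.τ k (ω.2 x)

/-- The set `R` of realised individuals. -/
def realised (ω : PopulationSpace S Ωl) : Set Individual := {x | B.birthTime x ω < ∞}

/-- The map `S_x = (σ_x, U_{Pr x})`, which makes `x` the new ancestor. -/
def shift (x : Individual) (ω : PopulationSpace S Ωl) : PopulationSpace S Ωl :=
  (B.typeOf x ω, fun z => ω.2 (z ++ x))

/-- The event `E` of extinction: only finitely many individuals are realised. -/
def extinction : Set (PopulationSpace S Ωl) := {ω | (B.realised ω).Finite}

/-- The σ-algebra `F_R` of the events pertaining only to realised individuals, generated by the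
type of the ancestor and by the events `{x ∈ R, U_x ∈ C}`. -/
@[reducible] def realisedSigma : MeasurableSpace (PopulationSpace S Ωl) :=
  MeasurableSpace.comap Prod.fst inferInstance ⊔
    MeasurableSpace.generateFrom
      {A | ∃ (x : Individual) (C : Set Ωl), MeasurableSet C ∧
        A = {ω | x ∈ B.realised ω ∧ ω.2 x ∈ C}}

/-- The type of the individual with number `n + 1`, as a function of the lives of the individuals
with numbers `0, …, n`, which include her mother. -/
def nextType (n : ℕ) (h : (i : Finset.Iic n) → Ωl) : S :=
  B.σ (Denumerable.ofNat Individual (n + 1)).headI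
    (h ⟨Encodable.encode (Denumerable.ofNat Individual (n + 1)).tail,
      Finset.mem_Iic.2 (encode_mother_le n)⟩)

theorem measurable_nextType (n : ℕ) : Measurable (B.nextType n) :=
  (B.measurable_σ _).comp (measurable_pi_apply _)

/-- Given the lives of the individuals with numbers `0, …, n`, the next individual lives according
to the life kernel at her own type. -/
noncomputable def step (n : ℕ) : Kernel ((i : Finset.Iic n) → Ωl) Ωl :=
  B.life.comap (B.nextType n) (B.measurable_nextType n)

instance (n : ℕ) : IsMarkovKernel (B.step n) :=
  have := B.isMarkovKernel_life
  inferInstanceAs (IsMarkovKernel (B.life.comap _ _))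

/-- The population law `ℙ_s` of the process whose ancestor has type `s`, as a kernel. The lives of
the individuals are drawn one after another (by the theorem of Ionescu-Tulcea), mothers before
their daughters: the life of the ancestor from `life s`, the life of any other individual `x`
from `life σ_x`, given all the lives drawn before. -/
noncomputable def law : Kernel S (PopulationSpace S Ωl) :=
  Kernel.id ×ₖ
    ((Kernel.traj (X := fun _ => Ωl) B.step 0 ∘ₖ B.life.map (fun w _ => w)).map
      (fun h (x : Individual) => h (Encodable.encode x)))

instance : IsMarkovKernel B.law := by
  have := B.isMarkovKernel_life
  have : IsMarkovKernel
      (B.life.map (fun w (_ : Finset.Iic 0) => w)) :=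
    Kernel.IsMarkovKernel.map _ (measurable_pi_lambda _ fun _ => measurable_id)
  have : IsMarkovKernel
      ((Kernel.traj (X := fun _ => Ωl) B.step 0 ∘ₖ B.life.map (fun w _ => w)).map
        (fun h (x : Individual) => h (Encodable.encode x))) :=
    Kernel.IsMarkovKernel.map _ (measurable_pi_lambda _ fun _ => measurable_pi_apply _)
  unfold law
  infer_instance

/-- The extinction probability `q_s`. -/
noncomputable def extinctionProb (s : S) : ℝ≥0∞ := B.law s B.extinction

theorem measurable_birthTime (x : Individual) : Measurable (B.birthTime x) := by
  induction x with
  | nil => exact measurable_const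
  | cons k x ih =>
    exact ih.add ((B.measurable_τ k).comp ((measurable_pi_apply x).comp measurable_snd))

theorem measurableSet_mem_realised (x : Individual) :
    MeasurableSet {ω : PopulationSpace S Ωl | x ∈ B.realised ω} :=
  measurableSet_lt (B.measurable_birthTime x) measurable_const

theorem measurableSet_extinction : MeasurableSet B.extinction := by
  have e : B.extinction =
      ⋃ F : Finset Individual, ⋂ x ∈ {x | x ∉ F}, {ω | x ∈ B.realised ω}ᶜ := by
    ext ω
    simp only [extinction, mem_ofPred_eq, mem_iUnion, mem_iInter, mem_compl_iff]
    constructor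
    · intro h
      exact ⟨h.toFinset, fun x hx hR => hx (h.mem_toFinset.2 hR)⟩
    · rintro ⟨F, hF⟩
      refine F.finite_toSet.subset fun x hx => ?_
      by_contra hn
      exact hF x hn hx
  rw [e]
  exact MeasurableSet.iUnion fun F => MeasurableSet.biInter (to_countable _) fun x _ =>
    (B.measurableSet_mem_realised x).compl

/-- The conditioned population law `ℙ_s( · | E)`, as a kernel. -/
noncomputable def condLaw : Kernel S (PopulationSpace S Ωl) where
  toFun s := (B.law s)[|B.extinction]
  measurable' := by
    refine Measure.measurable_of_measurable_coe _ fun A hA => ?_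
    simp only [cond_apply B.measurableSet_extinction]
    exact (B.law.measurable_coe B.measurableSet_extinction).inv.mul
      (B.law.measurable_coe (B.measurableSet_extinction.inter hA))

/-- The branching process with the same life space and the life kernel
`A ↦ ℙ_s(S × A × Ωl ^ (T \ {e}) | E)`. -/
noncomputable def conditioned (hq : ∀ s, 0 < B.extinctionProb s) : BranchingProcess S Ωl where
  τ := B.τ
  measurable_τ := B.measurable_τ
  monotone_τ := B.monotone_τ
  σ := B.σ
  measurable_σ := B.measurable_σ
  life := B.condLaw.map fun ω => ω.2 []
  isMarkovKernel_life := by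
    have : IsMarkovKernel B.condLaw := ⟨fun s => cond_isProbabilityMeasure (hq s).ne'⟩
    exact Kernel.IsMarkovKernel.map _ ((measurable_pi_apply _).comp measurable_snd)

theorem measurableSet_preLine_mem_realised {M : Set Individual} (hM : IsLine M) {x : Individual}
    (hx : x ∈ M) (y : Individual) (hy : y <:+ x) :
    MeasurableSet[preLine S Ωl M] {ω : PopulationSpace S Ωl | y ∈ B.realised ω} := by
  suffices h : Measurable[preLine S Ωl M] (B.birthTime y) from
    h measurableSet_Iio
  induction y with
  | nil => exact @measurable_const _ _ _ (_) _
  | cons k y ih =>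
    have hyx : y <:+ x := (List.suffix_cons k y).trans hy
    have hn : y ∈ (progeny M)ᶜ := by
      rintro ⟨z, hz, hzy⟩
      have hzx : z ≠ x := by
        rintro rfl
        have h1 := hzy.length_le
        have h2 := hy.length_le
        simp only [List.length_cons] at h2
        omega
      exact hM z hz x hx hzx (Or.inl (hzy.trans hyx))
    have hU : Measurable[preLine S Ωl M] (fun ω : PopulationSpace S Ωl => ω.2 y) := by
      refine Measurable.mono (comap_measurable _) ?_ le_rfl
      exact le_sup_of_le_right (le_iSup₂_of_le y hn le_rfl)
    exact Measurable.add (m := preLine S Ωl M) (f := B.birthTime y) (g := fun ω => B.τ k (ω.2 y))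
      (ih hyx) ((B.measurable_τ k).comp hU)

/-- The realised part of a line is an optional line. -/
theorem isOptional_inter_realised {L : Set Individual} (hL : IsLine L) :
    IsOptional fun ω : PopulationSpace S Ωl => L ∩ B.realised ω := by
  refine ⟨fun ω x hx y hy => hL x hx.1 y hy.1, fun M hM => ?_⟩
  have e : {ω : PopulationSpace S Ωl | Precedes (L ∩ B.realised ω) M} =
      ⋂ x ∈ M, ⋃ y ∈ {y | y ∈ L ∧ y <:+ x}, {ω | y ∈ B.realised ω} := by
    ext ω
    simp only [Precedes, progeny, mem_ofPred_eq, mem_iInter, mem_iUnion, mem_inter_iff]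
    constructor
    · intro h x hx
      obtain ⟨y, ⟨h1, h2⟩, h3⟩ := h x hx
      exact ⟨y, ⟨h1, h3⟩, h2⟩
    · intro h x hx
      obtain ⟨y, ⟨h1, h3⟩, h2⟩ := h x hx
      exact ⟨y, ⟨h1, h2⟩, h3⟩
  rw [e]
  exact @MeasurableSet.biInter _ _ (preLine S Ωl M) _ _ (to_countable M) fun x hx =>
    @MeasurableSet.biUnion _ _ (preLine S Ωl M) _ _ (to_countable _) fun y hy =>
      B.measurableSet_preLine_mem_realised hM hx y hy.2

/-- The σ-algebra `F_{L ∩ R}`, for a line `L`. -/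
@[reducible] def realisedPreLine {L : Set Individual} (hL : IsLine L) :
    MeasurableSpace (PopulationSpace S Ωl) :=
  (B.isOptional_inter_realised hL).sigma

theorem realisedPreLine_le {L : Set Individual} (hL : IsLine L) :
    B.realisedPreLine hL ≤ (inferInstance : MeasurableSpace (PopulationSpace S Ωl)) :=
  (B.isOptional_inter_realised hL).sigma_le

end BranchingProcess

/-! Extinction factorises along lines. If `M` is a finite set of realised individuals, the
population dies out exactly when finitely many realised individuals lie outside the progeny of `M`
and every population `S_x ω`, `x ∈ M`, dies out (`mem_extinction_iff`). Combined with the branching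
property of `ℙ_s` at a finite line `M`, this turns the integral over `E` of `f ∏ 1_{A_x}(S_x)`, with
`f` determined off the progeny of `M` and supported where `M` is realised, into that of `f 1_G ∏
ℙ_{σ_x}(A_x ∩ E)`, where `G` says that finitely many realised individuals lie outside the progeny.
Since `ℙ_r(A ∩ E) = q_r ℙ̃_r(A)`, comparing with the case of all `A_x = Ω` gives the branching
property of `ℙ̃_s`, while that case alone yields the density `q_s⁻¹ ∏ q_{σ_x}`. Taking `M = {x}`
shows that under `ℙ̃_s` a realised `x` lives according to `P̃(σ_x, ·)`. Induction along the
numbering then identifies `ℙ̃_s` with the law of the new process, but only on `ℱ_ℛ`: extinction puts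
no bias on unrealised lives. As `E` belongs to `ℱ_ℛ` and `ℙ̃_s(E) = 1`, the new process dies out.
For a line `L`, the space splits, up to a null set, according to the countably many possible finite
values `M` of `L ∩ ℛ`, each being a deterministic finite line. The branching property of `ℙ_s` comes
from the Ionescu-Tulcea chain, which describes each life given those with smaller numbers only. The
extension to all lives off the progeny, and then to whole shifted populations, is a uniqueness
argument: finite measures that agree initially and have the same one-step conditional probabilities
agree (`measure_eq_on_iSup`). -/

/-! ### Uniqueness of measures with common conditional probabilities -/

theorem setLIntegral_eq_of_agree {α : Type*} {m m0 : MeasurableSpace α} (hm : m ≤ m0)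
    {μ ν : Measure α} (h : ∀ A, MeasurableSet[m] A → μ A = ν A) {f : α → ℝ≥0∞}
    (hf : Measurable[m] f) {A : Set α} (hA : MeasurableSet[m] A) :
    ∫⁻ a in A, f a ∂μ = ∫⁻ a in A, f a ∂ν := by
  have e : μ.trim hm = ν.trim hm := by
    refine @Measure.ext _ m _ _ fun B hB => ?_
    rw [trim_measurableSet_eq hm hB, trim_measurableSet_eq hm hB, h B hB]
  rw [← setLIntegral_trim hm hf hA, e, setLIntegral_trim hm hf hA]

/-- Two finite measures that agree on `m` agree on `m ⊔ generateFrom G`, if the traces on `m` of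
their restrictions to the members of the π-system `G` have a common density. -/
theorem measure_eq_of_common_density {α : Type*} {m m0 : MeasurableSpace α} (hm : m ≤ m0)
    {μ ν : Measure α} [IsFiniteMeasure μ] (h : ∀ A, MeasurableSet[m] A → μ A = ν A)
    {G : Set (Set α)} (hG : IsPiSystem G) (hG0 : ∀ B ∈ G, MeasurableSet B)
    (hκ : ∀ B ∈ G, ∃ κ : α → ℝ≥0∞, Measurable[m] κ ∧ ∀ A, MeasurableSet[m] A →
      μ (A ∩ B) = ∫⁻ a in A, κ a ∂μ ∧ ν (A ∩ B) = ∫⁻ a in A, κ a ∂ν)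
    {A : Set α} (hA : MeasurableSet[m ⊔ MeasurableSpace.generateFrom G] A) : μ A = ν A := by
  -- Adjoining `univ` to `G` puts the members of `m` themselves into the generating π-system.
  let C : Set (Set α) := {D | ∃ A, MeasurableSet[m] A ∧ ∃ B ∈ insert univ G, D = A ∩ B}
  have hG' : IsPiSystem (insert univ G) := hG.insert_univ
  have hC : IsPiSystem C := by
    rintro _ ⟨A, hA, B, hB, rfl⟩ _ ⟨A', hA', B', hB', rfl⟩ hne
    refine ⟨A ∩ A', hA.inter hA', B ∩ B', hG' _ hB _ hB' ?_, by ext; simp; tauto⟩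
    obtain ⟨a, ha⟩ := hne
    exact ⟨a, ha.1.2, ha.2.2⟩
  have e : m ⊔ MeasurableSpace.generateFrom G = MeasurableSpace.generateFrom C := by
    apply le_antisymm
    · refine sup_le (fun A hA => ?_) (MeasurableSpace.generateFrom_le fun B hB => ?_)
      · exact MeasurableSpace.measurableSet_generateFrom ⟨A, hA, univ, mem_insert _ _, by simp⟩
      · exact MeasurableSpace.measurableSet_generateFrom
          ⟨univ, MeasurableSet.univ, B, mem_insert_of_mem _ hB, by simp⟩
    · refine MeasurableSpace.generateFrom_le ?_
      rintro _ ⟨A, hA, B, hB, rfl⟩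
      refine @MeasurableSet.inter _ (m ⊔ MeasurableSpace.generateFrom G) _ _
        ((le_sup_left : m ≤ _) _ hA) ?_
      rcases hB with rfl | hB
      · exact @MeasurableSet.univ _ _
      · exact (le_sup_right : MeasurableSpace.generateFrom G ≤ _) _
          (MeasurableSpace.measurableSet_generateFrom hB)
  refine ext_on_measurableSpace_of_generate_finite m0 C ?_
    (sup_le hm (MeasurableSpace.generateFrom_le hG0)) e hC (h _ (@MeasurableSet.univ _ m)) hA
  rintro _ ⟨A, hA, B, hB, rfl⟩
  rcases hB with rfl | hB
  · simpa using h A hA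
  · obtain ⟨κ, hκm, hκ⟩ := hκ B hB
    rw [(hκ A hA).1, (hκ A hA).2, setLIntegral_eq_of_agree hm h hκm hA]

/-- The inductive form of `measure_eq_of_common_density`. -/
theorem measure_eq_on_iSup {α : Type*} {m0 : MeasurableSpace α} {H : ℕ → MeasurableSpace α}
    (hH0 : ∀ n, H n ≤ m0) (hH : Monotone H) {μ ν : Measure α} [IsFiniteMeasure μ]
    (h : ∀ A, MeasurableSet[H 0] A → μ A = ν A) {G : ℕ → Set (Set α)}
    (hG : ∀ n, IsPiSystem (G n)) (hG0 : ∀ n, ∀ B ∈ G n, MeasurableSet B)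
    (hHG : ∀ n, H (n + 1) ≤ H n ⊔ MeasurableSpace.generateFrom (G n))
    (hκ : ∀ n, ∀ B ∈ G n, ∃ κ : α → ℝ≥0∞, Measurable[H n] κ ∧ ∀ A, MeasurableSet[H n] A →
      μ (A ∩ B) = ∫⁻ a in A, κ a ∂μ ∧ ν (A ∩ B) = ∫⁻ a in A, κ a ∂ν)
    {A : Set α} (hA : MeasurableSet[⨆ n, H n] A) : μ A = ν A := by
  have key : ∀ n, ∀ A, MeasurableSet[H n] A → μ A = ν A := by
    intro n
    induction n with
    | zero => exact h
    | succ n ih =>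
      intro A hA
      exact measure_eq_of_common_density (hH0 n) ih (hG n) (hG0 n) (hκ n) (hHG n A hA)
  refine ext_on_measurableSpace_of_generate_finite m0 (⋃ n, {t | MeasurableSet[H n] t}) ?_
    (iSup_le hH0) (MeasurableSpace.generateFrom_iUnion_measurableSet H).symm
    (isPiSystem_iUnion_of_monotone _ (fun n => @MeasurableSpace.isPiSystem_measurableSet _ (H n))
      fun _ _ hmn => hH hmn) (h _ (@MeasurableSet.univ _ (H 0))) hA
  intro A hA
  obtain ⟨n, hn⟩ := mem_iUnion.1 hA
  exact key n A hn

/-! ### σ-algebras generated by lives -/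

namespace UlamHarris

variable {S Ωl : Type*} [MeasurableSpace S] [MeasurableSpace Ωl]

/-- The σ-algebra generated by the type of the ancestor and the lives of the members of `V`. -/
@[reducible] def livesSigma (S Ωl : Type*) [MeasurableSpace S] [MeasurableSpace Ωl]
    (V : Set Individual) : MeasurableSpace (PopulationSpace S Ωl) :=
  MeasurableSpace.comap Prod.fst inferInstance ⊔
    ⨆ x ∈ V, MeasurableSpace.comap (fun ω => ω.2 x) inferInstance

theorem measurable_fst_livesSigma (V : Set Individual) :
    Measurable[livesSigma S Ωl V] (fun ω : PopulationSpace S Ωl => ω.1) :=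
  Measurable.mono (comap_measurable _) le_sup_left le_rfl

theorem measurable_life_livesSigma {V : Set Individual} {x : Individual} (hx : x ∈ V) :
    Measurable[livesSigma S Ωl V] (fun ω : PopulationSpace S Ωl => ω.2 x) :=
  Measurable.mono (comap_measurable _) (le_sup_of_le_right (le_iSup₂_of_le x hx le_rfl)) le_rfl

theorem livesSigma_le_of {V : Set Individual} {m : MeasurableSpace (PopulationSpace S Ωl)}
    (h1 : Measurable[m] (fun ω : PopulationSpace S Ωl => ω.1))
    (h2 : ∀ x ∈ V, Measurable[m] (fun ω : PopulationSpace S Ωl => ω.2 x)) :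
    livesSigma S Ωl V ≤ m :=
  sup_le h1.comap_le (iSup₂_le fun x hx => (h2 x hx).comap_le)

theorem livesSigma_mono {V W : Set Individual} (h : V ⊆ W) :
    livesSigma S Ωl V ≤ livesSigma S Ωl W :=
  livesSigma_le_of (measurable_fst_livesSigma W) fun _ hx => measurable_life_livesSigma (h hx)

theorem livesSigma_le (V : Set Individual) :
    livesSigma S Ωl V ≤ (inferInstance : MeasurableSpace (PopulationSpace S Ωl)) :=
  livesSigma_le_of measurable_fst fun x _ => (measurable_pi_apply x).comp measurable_snd

theorem livesSigma_univ :
    livesSigma S Ωl univ = (inferInstance : MeasurableSpace (PopulationSpace S Ωl)) := by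
  refine le_antisymm (livesSigma_le _) ?_
  have h : Measurable[livesSigma S Ωl univ] (fun ω : PopulationSpace S Ωl => (ω.1, ω.2)) :=
    Measurable.prodMk (measurable_fst_livesSigma _)
      (@measurable_pi_lambda _ _ _ (livesSigma S Ωl univ) _ _
        fun x => measurable_life_livesSigma (mem_univ x))
  intro A hA
  exact h hA

theorem livesSigma_iUnion_le (V : ℕ → Set Individual) :
    livesSigma S Ωl (⋃ n, V n) ≤ ⨆ n, livesSigma S Ωl (V n) := by
  refine livesSigma_le_of ?_ fun x hx => ?_
  · exact Measurable.mono (measurable_fst_livesSigma (V 0)) (le_iSup (fun n => livesSigma S Ωl (V n)) 0)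
      le_rfl
  · obtain ⟨n, hn⟩ := mem_iUnion.1 hx
    exact Measurable.mono (measurable_life_livesSigma hn) (le_iSup (fun n => livesSigma S Ωl (V n)) n)
      le_rfl

theorem encode_mother_lt (k : ℕ) (x : Individual) :
    Encodable.encode x < Encodable.encode (k :: x) := by
  rw [Encodable.encode_list_cons]
  exact Nat.lt_succ_of_le (Nat.right_le_pair _ _)

theorem encode_le_of_suffix {x y : Individual} (h : x <:+ y) :
    Encodable.encode x ≤ Encodable.encode y := by
  obtain ⟨z, rfl⟩ := h
  induction z with
  | nil => simp
  | cons k z ih => exact ih.trans (encode_mother_lt k _).le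

end UlamHarris

/-! ### The branching property at one individual -/

namespace BranchingProcess

variable {S Ωl : Type*} [MeasurableSpace S] [MeasurableSpace Ωl] (B : BranchingProcess S Ωl)

/-- The type of `x` is determined by the life of her mother. -/
theorem measurable_typeOf_livesSigma {V : Set Individual} {x : Individual}
    (h : ∀ k y, x = k :: y → y ∈ V) : Measurable[livesSigma S Ωl V] (B.typeOf x) := by
  cases x with
  | nil => exact measurable_fst_livesSigma V
  | cons k y => exact (B.measurable_σ k).comp (measurable_life_livesSigma (h k y rfl))

theorem measurable_typeOf (x : Individual) : Measurable (B.typeOf x) :=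
  (B.measurable_typeOf_livesSigma (V := univ) (x := x) fun _ _ _ => mem_univ _).mono
    (livesSigma_le _) le_rfl

/-- The lives of the individuals in the standard numbering form a trajectory of the Markov chain of
Ionescu-Tulcea. -/
theorem law_eq_map_trajMeasure (s : S) :
    B.law s = (@Kernel.trajMeasure (fun _ => Ωl) _ (B.life s) B.step _).map
      (fun h => (s, fun x : Individual => h (Encodable.encode x))) := by
  have := B.isMarkovKernel_life
  have hm : Measurable fun (h : ℕ → Ωl) (x : Individual) => h (Encodable.encode x) :=
    measurable_pi_lambda _ fun _ => measurable_pi_apply _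
  have hm' : Measurable fun (w : Ωl) (_ : Finset.Iic 0) => w :=
    measurable_pi_lambda _ fun _ => measurable_id
  have : IsMarkovKernel (B.life.map (fun w (_ : Finset.Iic 0) => w)) :=
    Kernel.IsMarkovKernel.map _ hm'
  have e : ((Kernel.traj (X := fun _ => Ωl) B.step 0 ∘ₖ B.life.map (fun w _ => w)) s) =
      @Kernel.trajMeasure (fun _ => Ωl) _ (B.life s) B.step _ := by
    rw [Kernel.comp_apply, Kernel.map_apply _ hm', Kernel.trajMeasure]
    congr 1
  have : IsMarkovKernel (Kernel.traj (X := fun _ => Ωl) B.step 0 ∘ₖ B.life.map (fun w _ => w)) :=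
    inferInstance
  have : IsMarkovKernel
      ((Kernel.traj (X := fun _ => Ωl) B.step 0 ∘ₖ B.life.map (fun w _ => w)).map
        (fun h (x : Individual) => h (Encodable.encode x))) :=
    Kernel.IsMarkovKernel.map _ hm
  rw [law, Kernel.prod_apply, Kernel.id_apply, Measure.dirac_prod, Kernel.map_apply _ hm, e,
    Measure.map_map measurable_prodMk_left hm]
  rfl

theorem law_map_fst (s : S) : (B.law s).map Prod.fst = Measure.dirac s := by
  have := B.isMarkovKernel_life
  have hm : Measurable fun (h : ℕ → Ωl) => (s, fun x : Individual => h (Encodable.encode x)) :=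
    measurable_prodMk_left.comp (measurable_pi_lambda _ fun _ => measurable_pi_apply _)
  rw [law_eq_map_trajMeasure, Measure.map_map measurable_fst hm]
  exact (Measure.map_const _ _).trans (by simp)

theorem trajMeasure_map_zero (s : S) :
    (@Kernel.trajMeasure (fun _ => Ωl) _ (B.life s) B.step _).map (fun h => h 0) = B.life s := by
  have := B.isMarkovKernel_life
  have e : (@Kernel.trajMeasure (fun _ => Ωl) _ (B.life s) B.step _).map
      (Preorder.frestrictLe (π := fun _ => Ωl) 0) =
      (B.life s).map (MeasurableEquiv.piUnique (fun _ : Finset.Iic 0 => Ωl)).symm := by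
    rw [Kernel.trajMeasure, Measure.map_comp _ _ (by fun_prop), Kernel.traj_map_frestrictLe,
      Kernel.partialTraj_self, Measure.id_comp]
  have e2 : (fun h : ℕ → Ωl => h 0) =
      (fun g : (i : Finset.Iic 0) → Ωl => g ⟨0, by simp⟩) ∘
        (Preorder.frestrictLe (π := fun _ => Ωl) 0) := rfl
  rw [e2, ← Measure.map_map (measurable_pi_apply _) (by fun_prop), e,
    Measure.map_map (measurable_pi_apply _) (MeasurableEquiv.measurable _)]
  exact Measure.map_id

/-- Given the lives of all individuals with smaller numbers, an individual lives according to the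
life kernel at her own type. -/
theorem law_inter_life_of_lt (s : S) (x : Individual) {A : Set (PopulationSpace S Ωl)}
    (hA : MeasurableSet[livesSigma S Ωl {y | Encodable.encode y < Encodable.encode x}] A)
    {C : Set Ωl} (hC : MeasurableSet C) :
    B.law s (A ∩ {ω | ω.2 x ∈ C}) = ∫⁻ ω in A, B.life (B.typeOf x ω) C ∂B.law s := by
  have := B.isMarkovKernel_life
  set μ := @Kernel.trajMeasure (fun _ => Ωl) _ (B.life s) B.step _ with hμ
  set Φ : (ℕ → Ωl) → PopulationSpace S Ωl :=
    fun h => (s, fun x : Individual => h (Encodable.encode x)) with hΦ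
  have hΦm : Measurable Φ :=
    measurable_prodMk_left.comp (measurable_pi_lambda _ fun _ => measurable_pi_apply _)
  have hA0 : MeasurableSet A := livesSigma_le _ _ hA
  have hCx : MeasurableSet {ω : PopulationSpace S Ωl | ω.2 x ∈ C} :=
    (measurable_pi_apply x).comp measurable_snd hC
  have hlaw : B.law s = μ.map Φ := B.law_eq_map_trajMeasure s
  have hint : Measurable fun ω : PopulationSpace S Ωl => B.life (B.typeOf x ω) C :=
    (B.life.measurable_coe hC).comp (B.measurable_typeOf x)
  rw [hlaw, Measure.map_apply hΦm (hA0.inter hCx), setLIntegral_map hA0 hint hΦm]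
  obtain ⟨n, rfl⟩ : ∃ n, x = Denumerable.ofNat Individual n :=
    ⟨Encodable.encode x, (Denumerable.ofNat_encode x).symm⟩
  rw [Denumerable.encode_ofNat] at hA
  cases n with
  | zero =>
    have h0 : Denumerable.ofNat Individual 0 = [] := by
      rw [← Denumerable.ofNat_encode ([] : Individual), Encodable.encode_list_nil]
    -- Nothing precedes the ancestor except her type, which is the constant `s` along `Φ`; so `A`
    -- pulls back to `∅` or to everything.
    have hle : livesSigma S Ωl {y | Encodable.encode y < 0} ≤ MeasurableSpace.map Φ ⊥ :=
      livesSigma_le_of (@measurable_const _ _ _ (MeasurableSpace.map Φ ⊥) s)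
        fun y hy => absurd hy (Nat.not_lt_zero _)
    rw [h0] at hCx hint ⊢
    have hlife : μ {h | h 0 ∈ C} = B.life s C := by
      rw [← B.trajMeasure_map_zero s, Measure.map_apply (measurable_pi_apply 0) hC]
      rfl
    have hpre : Φ ⁻¹' {ω | ω.2 [] ∈ C} = {h | h 0 ∈ C} := by
      ext h
      simp [hΦ, Encodable.encode_list_nil]
    rcases MeasurableSpace.measurableSet_bot_iff.1 (hle _ hA) with h | h
    · rw [preimage_inter, h]
      simp
    · rw [preimage_inter, h, hpre, univ_inter, hlife, setLIntegral_univ]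
      change _ = ∫⁻ _, B.life s C ∂μ
      simp
  | succ n =>
    -- Along `Φ` the past is a function of the coordinates `0, …, n`, so the one-step disintegration
    -- of the trajectory measure applies.
    have hle : livesSigma S Ωl {y | Encodable.encode y < n + 1} ≤ MeasurableSpace.map Φ
        (MeasurableSpace.comap (Preorder.frestrictLe (π := fun _ => Ωl) n) inferInstance) := by
      refine livesSigma_le_of (@measurable_const _ _ _ (MeasurableSpace.map Φ _) s)
        fun y hy C hC => ?_
      exact ⟨{g | g ⟨Encodable.encode y, Finset.mem_Iic.2 (Nat.lt_succ_iff.1 hy)⟩ ∈ C},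
        measurable_pi_apply _ hC, rfl⟩
    obtain ⟨D, hD, hDA⟩ := hle _ hA
    have hkey := congrArg (fun ρ => ρ (D ×ˢ C))
      (@Kernel.map_frestrictLe_trajMeasure_compProd_eq_map_trajMeasure
        (fun _ => Ωl) _ B.step _ (B.life s) _ n)
    have hm : Measurable fun h : ℕ → Ωl => (Preorder.frestrictLe (π := fun _ => Ωl) n h, h (n + 1)) :=
      Measurable.prodMk (by fun_prop) (measurable_pi_apply _)
    simp only [← hμ] at hkey
    rw [Measure.compProd_apply_prod hD hC, Measure.map_apply hm (hD.prod hC),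
      setLIntegral_map hD ((B.step n).measurable_coe hC) (by fun_prop)] at hkey
    have e1 : Φ ⁻¹' (A ∩ {ω | ω.2 (Denumerable.ofNat Individual (n + 1)) ∈ C}) =
        (fun h : ℕ → Ωl => (Preorder.frestrictLe (π := fun _ => Ωl) n h, h (n + 1))) ⁻¹' D ×ˢ C := by
      rw [preimage_inter, ← hDA]
      ext h
      simp [hΦ]
    rw [e1, ← hkey, hDA]
    refine lintegral_congr fun h => ?_
    have e2 : B.nextType n (Preorder.frestrictLe (π := fun _ => Ωl) n h) =
        B.typeOf (Denumerable.ofNat Individual (n + 1)) (Φ h) := by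
      have h1 : Encodable.encode (Denumerable.ofNat Individual (n + 1)) = n + 1 :=
        Denumerable.encode_ofNat (n + 1)
      unfold nextType
      change B.σ _ (h (Encodable.encode (Denumerable.ofNat Individual (n + 1)).tail)) = _
      cases hx : Denumerable.ofNat Individual (n + 1) with
      | nil => rw [hx, Encodable.encode_list_nil] at h1; omega
      | cons k y => rfl
    rw [step, Kernel.comap_apply, e2]

end BranchingProcess

/-- The hypothesis makes `κ` act as a conditional probability of `E` given `m`: on `m`, restriction
to `E` and the density `κ` give the same measure, hence the same integrals of `m`-measurable
functions. -/
theorem setLIntegral_inter_eq {α : Type*} {m m0 : MeasurableSpace α} (hm : m ≤ m0)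
    {μ : Measure α} {E : Set α} {κ : α → ℝ≥0∞} (hκ : Measurable κ)
    (h : ∀ A, MeasurableSet[m] A → μ (A ∩ E) = ∫⁻ a in A, κ a ∂μ)
    {f : α → ℝ≥0∞} (hf : Measurable[m] f) {A : Set α} (hA : MeasurableSet[m] A) :
    ∫⁻ a in A ∩ E, f a ∂μ = ∫⁻ a in A, κ a * f a ∂μ := by
  have e := setLIntegral_eq_of_agree hm (μ := μ.restrict E) (ν := μ.withDensity κ)
    (fun A hA => by rw [Measure.restrict_apply (hm _ hA), h A hA, withDensity_apply _ (hm _ hA)])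
    hf hA
  rw [Measure.restrict_restrict (hm _ hA)] at e
  rw [e, setLIntegral_withDensity_eq_setLIntegral_mul _ hκ (hf.mono hm le_rfl) (hm _ hA)]
  rfl

namespace BranchingProcess

variable {S Ωl : Type*} [MeasurableSpace S] [MeasurableSpace Ωl] (B : BranchingProcess S Ωl)

theorem measurableSet_life_mem (x : Individual) {C : Set Ωl} (hC : MeasurableSet C) :
    MeasurableSet {ω : PopulationSpace S Ωl | ω.2 x ∈ C} :=
  (measurable_pi_apply x).comp measurable_snd hC

theorem measurable_life_typeOf (x : Individual) {C : Set Ωl} (hC : MeasurableSet C) :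
    Measurable fun ω => B.life (B.typeOf x ω) C :=
  (B.life.measurable_coe hC).comp (B.measurable_typeOf x)

theorem typeOf_measurable_lt (x : Individual) :
    Measurable[livesSigma S Ωl {y | Encodable.encode y < Encodable.encode x}] (B.typeOf x) := by
  refine B.measurable_typeOf_livesSigma ?_
  rintro k y rfl
  exact encode_mother_lt k y

/-- Given the lives of all individuals that do not stem from her, an individual lives according to
the life kernel at her own type. -/
theorem law_inter_life (s : S) (x : Individual) {A : Set (PopulationSpace S Ωl)}
    (hA : MeasurableSet[livesSigma S Ωl (progeny {x})ᶜ] A) {C : Set Ωl} (hC : MeasurableSet C) :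
    B.law s (A ∩ {ω | ω.2 x ∈ C}) = ∫⁻ ω in A, B.life (B.typeOf x ω) C ∂B.law s := by
  set N := Encodable.encode x with hN
  set V : Set Individual := (progeny {x})ᶜ with hV
  have hxV : ∀ z ∈ V, z ≠ x := by
    rintro z hz rfl
    exact hz ⟨z, rfl, List.suffix_rfl⟩
  have hmV : ∀ k z, k :: z ∈ V → z ∈ V := by
    rintro k z hz ⟨y, hy, hyz⟩
    exact hz ⟨y, hy, hyz.trans (List.suffix_cons k z)⟩
  -- The individuals off the progeny of `x` are revealed in the order of their numbers, beginning
  -- with those that precede `x`.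
  let W : ℕ → Set Individual := fun n => V ∩ {y | Encodable.encode y < N + n}
  have hW : ⋃ n, W n = V := by
    ext y
    simp only [W, mem_iUnion, mem_inter_iff, mem_ofPred_eq]
    exact ⟨fun ⟨n, h, _⟩ => h, fun h => ⟨Encodable.encode y + 1, h, by omega⟩⟩
  have hCx := measurableSet_life_mem (S := S) x hC
  have hκx := B.measurable_life_typeOf x hC
  let z : ℕ → Individual := fun n => Denumerable.ofNat Individual (N + n)
  have hz : ∀ n, Encodable.encode (z n) = N + n := fun n => Denumerable.encode_ofNat _
  have hWlt : ∀ n, livesSigma S Ωl (W n) ≤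
      livesSigma S Ωl {y | Encodable.encode y < Encodable.encode (z n)} := fun n =>
    livesSigma_mono fun y hy => by rw [hz]; exact hy.2
  -- The claim becomes the equality of two measures on the σ-algebra of `V`: one restricted to `{U_x
  -- ∈ C}`, the other weighted by the conditional probability of this event. They agree on the past
  -- of `x`, and later lives in `V` follow the same kernels under both.
  have hAr : ∀ {A}, MeasurableSet A →
      (B.law s).restrict {ω | ω.2 x ∈ C} A = B.law s (A ∩ {ω | ω.2 x ∈ C}) := fun hA =>
    Measure.restrict_apply hA
  have hAd : ∀ {A}, MeasurableSet A →
      (B.law s).withDensity (fun ω => B.life (B.typeOf x ω) C) A =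
        ∫⁻ ω in A, B.life (B.typeOf x ω) C ∂B.law s := fun hA => withDensity_apply _ hA
  have hA0 : MeasurableSet A := livesSigma_le _ _ hA
  rw [← hAr hA0, ← hAd hA0]
  refine measure_eq_on_iSup (H := fun n => livesSigma S Ωl (W n))
    (G := fun n => {E | z n ∈ V ∧ ∃ D, MeasurableSet D ∧ E = {ω | ω.2 (z n) ∈ D}})
    -- If `z n` stems from `x` (in particular for `z 0 = x`), the family `G n` is empty and no life
    -- is adjoined.
    (fun n => livesSigma_le _)
    (fun m n hmn => livesSigma_mono fun y hy => ⟨hy.1, show _ < N + n from lt_of_lt_of_le hy.2 (Nat.add_le_add_left hmn N)⟩)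
    ?_ ?_ ?_ ?_ ?_ ?_
  · intro A hA
    have hA0 : MeasurableSet A := livesSigma_le _ _ hA
    rw [hAr hA0, hAd hA0]
    exact B.law_inter_life_of_lt s x (livesSigma_mono (fun y hy => hy.2) _ hA) hC
  · rintro n _ ⟨h, D, hD, rfl⟩ _ ⟨-, D', hD', rfl⟩ -
    exact ⟨h, D ∩ D', hD.inter hD', rfl⟩
  · rintro n _ ⟨-, D, hD, rfl⟩
    exact measurableSet_life_mem _ hD
  · intro n
    refine livesSigma_le_of ?_ fun y hy => ?_
    · exact (measurable_fst_livesSigma (W n)).mono le_sup_left le_rfl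
    · by_cases h : Encodable.encode y < N + n
      · exact (measurable_life_livesSigma (V := W n) ⟨hy.1, h⟩).mono le_sup_left le_rfl
      · have hyz : y = z n := by
          have h2 : Encodable.encode y < N + (n + 1) := hy.2
          have h3 : Encodable.encode y = N + n := by omega
          simp only [z]
          rw [← h3, Denumerable.ofNat_encode]
        subst hyz
        intro D hD
        exact (le_sup_right : _ ≤ livesSigma S Ωl (W n) ⊔ _) _
          (MeasurableSpace.measurableSet_generateFrom ⟨hy.1, D, hD, rfl⟩)
  · rintro n _ ⟨hzV, D, hD, rfl⟩
    have hDz := measurableSet_life_mem (S := S) (z n) hD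
    have hκz := B.measurable_life_typeOf (z n) hD
    have hlt : ∀ A, MeasurableSet[livesSigma S Ωl
        {y | Encodable.encode y < Encodable.encode (z n)}] A → _ :=
      fun A hA => B.law_inter_life_of_lt s (z n) hA hD
    refine ⟨fun ω => B.life (B.typeOf (z n) ω) D, ?_, fun A hA => ?_⟩
    · refine (B.life.measurable_coe hD).comp (B.measurable_typeOf_livesSigma ?_)
      intro k y hy
      rw [hy] at hzV
      refine ⟨hmV k y hzV, ?_⟩
      rw [mem_ofPred_eq, ← hz n, hy]
      exact encode_mother_lt k y
    · have hA0 : MeasurableSet A := livesSigma_le _ _ hA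
      rw [hAr (hA0.inter hDz), hAd (hA0.inter hDz), Measure.restrict_restrict hA0,
        setLIntegral_withDensity_eq_setLIntegral_mul _ hκx hκz hA0, inter_right_comm]
      constructor
      -- Since `z n ≠ x`, the number of `x` is strictly below `N + n`, so `{U_x ∈ C}` belongs to the
      -- past of `z n`.
      · refine hlt _ ((hWlt n _ hA).inter (measurable_life_livesSigma ?_ hC))
        have h1 : Encodable.encode x ≠ N + n := by
          rw [← hz n]
          exact fun h => hxV _ hzV (Encodable.encode_injective h).symm
        rw [mem_ofPred_eq, hz]
        omega
      · rw [setLIntegral_inter_eq (livesSigma_le _) hκz hlt ?_ (hWlt n _ hA)]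
        · simp only [Pi.mul_apply, mul_comm]
        · refine (B.life.measurable_coe hC).comp ((B.typeOf_measurable_lt x).mono ?_ le_rfl)
          refine livesSigma_mono fun y hy =>
            show _ < Encodable.encode (z n) from lt_of_lt_of_le hy ?_
          rw [hz]
          omega
  · refine (le_of_eq_of_le ?_ (livesSigma_iUnion_le W)) _ hA
    rw [hW]

theorem typeOf_shift (x z : Individual) (ω : PopulationSpace S Ωl) :
    B.typeOf z (B.shift x ω) = B.typeOf (z ++ x) ω := by
  cases z <;> rfl

theorem birthTime_append (x z : Individual) (ω : PopulationSpace S Ωl) :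
    B.birthTime (z ++ x) ω = B.birthTime x ω + B.birthTime z (B.shift x ω) := by
  induction z with
  | nil => simp [birthTime]
  | cons k z ih =>
    change B.birthTime (z ++ x) ω + B.τ k (ω.2 (z ++ x)) = _ + (_ + B.τ k (ω.2 (z ++ x)))
    rw [ih, add_assoc]

/-- The population stemming from `x` is determined by the lives of the mother of `x` and of the
progeny of `x`. -/
theorem measurable_shift_livesSigma {V W : Set Individual} {x : Individual}
    (h : ∀ k y, x = k :: y → y ∈ V) (hW : ∀ z ∈ W, z ++ x ∈ V) :
    Measurable[livesSigma S Ωl V, livesSigma S Ωl W] (B.shift x) := by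
  have hle : livesSigma S Ωl W ≤ MeasurableSpace.map (B.shift x) (livesSigma S Ωl V) := by
    refine livesSigma_le_of ?_ fun z hz => ?_
    · exact fun D hD => B.measurable_typeOf_livesSigma h hD
    · exact fun D hD => measurable_life_livesSigma (hW z hz) hD
  exact fun D hD => hle D hD

theorem measurable_shift (x : Individual) : Measurable (B.shift x) := by
  have h := B.measurable_shift_livesSigma (V := univ) (W := univ) (x := x)
    (fun _ _ _ => mem_univ _) fun _ _ => mem_univ _
  rwa [livesSigma_univ] at h

/-- The branching property at a single individual. -/
theorem law_inter_shift (s : S) (x : Individual) {A : Set (PopulationSpace S Ωl)}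
    (hA : MeasurableSet[livesSigma S Ωl (progeny {x})ᶜ] A) {D : Set (PopulationSpace S Ωl)}
    (hD : MeasurableSet D) :
    B.law s (A ∩ B.shift x ⁻¹' D) = ∫⁻ ω in A, B.law (B.typeOf x ω) D ∂B.law s := by
  have hA0 : MeasurableSet A := livesSigma_le _ _ hA
  have hS := B.measurable_shift x
  have hT := B.measurable_typeOf x
  set ρ := (B.law s).restrict A with hρ
  have hmap : ∀ {D}, MeasurableSet D → ρ.map (B.shift x) D = B.law s (A ∩ B.shift x ⁻¹' D) := by
    intro D hD
    rw [Measure.map_apply hS hD, Measure.restrict_apply (hS hD), inter_comm]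
  have hbind : ∀ {f : PopulationSpace S Ωl → ℝ≥0∞}, Measurable f →
      ∫⁻ ω, f ω ∂((ρ.map (B.typeOf x)).bind B.law) =
        ∫⁻ ω, ∫⁻ ω', f ω' ∂B.law (B.typeOf x ω) ∂ρ := by
    intro f hf
    rw [Measure.lintegral_bind B.law.measurable.aemeasurable hf.aemeasurable,
      lintegral_map hf.lintegral_kernel hT]
  have hbind' : ∀ {D}, MeasurableSet D →
      (ρ.map (B.typeOf x)).bind B.law D = ∫⁻ ω, B.law (B.typeOf x ω) D ∂ρ := by
    intro D hD
    rw [Measure.bind_apply hD B.law.measurable.aemeasurable,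
      lintegral_map (B.law.measurable_coe hD) hT]
  -- On `A`, the law of the shifted population is compared with the mixture of the laws `ℙ_r` over
  -- the type `r` of `x`. Both start from the same ancestor type and use the same life kernels.
  rw [← hmap hD, ← hbind' hD]
  let z : ℕ → Individual := fun n => Denumerable.ofNat Individual n
  have hz : ∀ n, Encodable.encode (z n) = n := fun n => Denumerable.encode_ofNat _
  refine measure_eq_on_iSup (H := fun n => livesSigma S Ωl {y | Encodable.encode y < n})
    (G := fun n => {E | ∃ D, MeasurableSet D ∧ E = {ω | ω.2 (z n) ∈ D}})
    (fun n => livesSigma_le _)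
    (fun m n hmn => livesSigma_mono fun y hy => show _ < n from lt_of_lt_of_le hy hmn) ?_ ?_ ?_ ?_ ?_ ?_
  · intro E hE
    have hE0 : MeasurableSet E := livesSigma_le _ _ hE
    have hle : livesSigma S Ωl {y | Encodable.encode y < 0} ≤
        MeasurableSpace.comap Prod.fst inferInstance :=
      livesSigma_le_of (comap_measurable _) fun y hy => absurd hy (Nat.not_lt_zero _)
    obtain ⟨D, hD, rfl⟩ := hle _ hE
    rw [Measure.map_apply hS hE0, hbind' hE0]
    have e : ∀ r, B.law r (Prod.fst ⁻¹' D) = D.indicator 1 r := by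
      intro r
      rw [← Measure.map_apply measurable_fst hD, law_map_fst, Measure.dirac_apply' _ hD]
    simp only [e]
    rw [← lintegral_map (measurable_one.indicator hD) hT, lintegral_indicator_one hD,
      Measure.map_apply hT hD]
    rfl
  · rintro n _ ⟨D, hD, rfl⟩ _ ⟨D', hD', rfl⟩ -
    exact ⟨D ∩ D', hD.inter hD', rfl⟩
  · rintro n _ ⟨D, hD, rfl⟩
    exact measurableSet_life_mem _ hD
  · intro n
    refine livesSigma_le_of ?_ fun y hy => ?_
    · exact (measurable_fst_livesSigma _).mono le_sup_left le_rfl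
    · by_cases h : Encodable.encode y < n
      · exact (measurable_life_livesSigma (V := {y | Encodable.encode y < n}) h).mono
          le_sup_left le_rfl
      · have hyz : y = z n := by
          have h2 : Encodable.encode y < n + 1 := hy
          have h3 : Encodable.encode y = n := by omega
          simp only [z]
          rw [← h3, Denumerable.ofNat_encode]
        subst hyz
        intro D hD
        exact (le_sup_right : _ ≤ livesSigma S Ωl _ ⊔ _) _
          (MeasurableSpace.measurableSet_generateFrom ⟨D, hD, rfl⟩)
  · rintro n _ ⟨D, hD, rfl⟩
    have hDz := measurableSet_life_mem (S := S) (z n) hD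
    have hκz := B.measurable_life_typeOf (z n) hD
    refine ⟨fun ω => B.life (B.typeOf (z n) ω) D, ?_, fun E hE => ?_⟩
    · have h := B.typeOf_measurable_lt (z n)
      rw [hz] at h
      exact (B.life.measurable_coe hD).comp h
    · have hE0 : MeasurableSet E := livesSigma_le _ _ hE
      constructor
      · rw [hmap (hE0.inter hDz), setLIntegral_map hE0 hκz hS, hρ,
          Measure.restrict_restrict (hS hE0), preimage_inter, ← inter_assoc,
          inter_comm (B.shift x ⁻¹' E)]
        simp only [typeOf_shift]
        -- Here `A` may involve lives with arbitrarily large numbers, so conditioning on smaller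
        -- numbers would not suffice. What matters is that neither `A` nor the shifted past of `z n`
        -- involves the progeny of `z n ++ x`.
        refine B.law_inter_life s (z n ++ x) (MeasurableSet.inter ?_ ?_) hD
        · refine livesSigma_mono (compl_subset_compl.2 ?_) _ hA
          rintro y ⟨_, rfl, hy⟩
          exact ⟨x, rfl, (List.suffix_append (z n) x).trans hy⟩
        · refine B.measurable_shift_livesSigma ?_ ?_ hE
          · rintro k y rfl ⟨_, rfl, hy⟩
            have h1 := hy.length_le
            simp only [List.length_append, List.length_cons] at h1
            omega
          · rintro y hy ⟨_, rfl, hzy⟩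
            have h1 : z n <:+ y := by
              obtain ⟨t, ht⟩ := hzy
              rw [← List.append_assoc] at ht
              exact ⟨t, List.append_cancel_right ht⟩
            have h2 := encode_le_of_suffix h1
            rw [hz] at h2
            exact absurd hy (not_lt.2 h2)
      · rw [hbind' (hE0.inter hDz), ← lintegral_indicator hE0, hbind (hκz.indicator hE0)]
        refine lintegral_congr fun ω => ?_
        rw [lintegral_indicator hE0]
        refine B.law_inter_life_of_lt _ (z n) ?_ hD
        rw [hz]
        exact hE
  · have e : ⋃ n, {y : Individual | Encodable.encode y < n} = univ := by
      ext y
      simp only [mem_iUnion, mem_ofPred_eq, mem_univ, iff_true]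
      exact ⟨_, Nat.lt_succ_self _⟩
    refine livesSigma_iUnion_le _ _ ?_
    rw [e, livesSigma_univ]
    exact hD

end BranchingProcess

namespace UlamHarris

theorem mother_notMem_progeny {M : Set Individual} (hM : IsLine M) {x : Individual} (hx : x ∈ M)
    (k : ℕ) (y : Individual) (h : x = k :: y) : y ∈ (progeny M)ᶜ := by
  rintro ⟨z, hz, hzy⟩
  have hlen := hzy.length_le
  refine hM z hz x hx ?_ (Or.inl ?_)
  · rintro rfl
    rw [h, List.length_cons] at hlen
    omega
  · rw [h]
    exact hzy.trans (List.suffix_cons k y)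

theorem append_notMem_progeny_singleton {x y : Individual} (h : ¬(x <:+ y ∨ y <:+ x))
    (z : Individual) : z ++ x ∈ (progeny {y})ᶜ := by
  rintro ⟨_, rfl, hy⟩
  exact h (List.suffix_or_suffix_of_suffix (List.suffix_append z x) hy)

theorem progeny_mono {M N : Set Individual} (h : M ⊆ N) : progeny M ⊆ progeny N :=
  fun _ ⟨y, hy, hyx⟩ => ⟨y, h hy, hyx⟩

theorem IsLine.mono {M N : Set Individual} (hN : IsLine N) (h : M ⊆ N) : IsLine M :=
  fun x hx y hy => hN x (h hx) y (h hy)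

end UlamHarris

/-! ### Extinction and the branching property at finite lines -/

namespace BranchingProcess

variable {S Ωl : Type*} [MeasurableSpace S] [MeasurableSpace Ωl] (B : BranchingProcess S Ωl)

theorem measurable_birthTime_livesSigma {V : Set Individual} {x : Individual}
    (h : ∀ k y, k :: y <:+ x → y ∈ V) : Measurable[livesSigma S Ωl V] (B.birthTime x) := by
  induction x with
  | nil => exact @measurable_const _ _ _ (_) _
  | cons k x ih =>
    exact Measurable.add (m := livesSigma S Ωl V) (f := B.birthTime x)
      (g := fun ω => B.τ k (ω.2 x))
      (ih fun j y hy => h j y (hy.trans (List.suffix_cons k x)))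
      ((B.measurable_τ k).comp (measurable_life_livesSigma (h k x List.suffix_rfl)))

theorem measurableSet_mem_realised_livesSigma {V : Set Individual} {x : Individual}
    (h : ∀ k y, k :: y <:+ x → y ∈ V) :
    MeasurableSet[livesSigma S Ωl V] {ω : PopulationSpace S Ωl | x ∈ B.realised ω} :=
  B.measurable_birthTime_livesSigma h measurableSet_Iio

theorem measurable_typeOf_preLine {M : Set Individual} (hM : IsLine M) {x : Individual}
    (hx : x ∈ M) : Measurable[livesSigma S Ωl (progeny M)ᶜ] (B.typeOf x) :=
  B.measurable_typeOf_livesSigma (mother_notMem_progeny hM hx)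

theorem mem_realised_of_suffix {x y : Individual} {ω : PopulationSpace S Ωl} (h : x <:+ y)
    (hy : y ∈ B.realised ω) : x ∈ B.realised ω := by
  obtain ⟨z, rfl⟩ := h
  have hy' : B.birthTime (z ++ x) ω < ∞ := hy
  rw [birthTime_append] at hy'
  exact lt_of_le_of_lt le_self_add hy'

theorem mem_realised_shift {x : Individual} {ω : PopulationSpace S Ωl} (hx : x ∈ B.realised ω)
    (z : Individual) : z ∈ B.realised (B.shift x ω) ↔ z ++ x ∈ B.realised ω := by
  have h : B.birthTime x ω < ∞ := hx
  simp only [realised, mem_ofPred_eq, birthTime_append, ENNReal.add_lt_top, h, true_and]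

/-- As each `x ∈ M` is born at a finite time, the realised set of `S_x ω` is the realised progeny of
`x`, translated. The whole realised set is thus its part off the progeny of `M` together with these
finitely many translates. -/
theorem mem_extinction_iff {M : Finset Individual} {ω : PopulationSpace S Ωl}
    (hM : ↑M ⊆ B.realised ω) : ω ∈ B.extinction ↔
      (B.realised ω \ progeny M).Finite ∧ ∀ x ∈ M, B.shift x ω ∈ B.extinction := by
  constructor
  · intro h
    refine ⟨h.subset sdiff_subset, fun x hx => ?_⟩
    have e : B.realised (B.shift x ω) = (fun z => z ++ x) ⁻¹' B.realised ω := by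
      ext z
      exact B.mem_realised_shift (hM hx) z
    change (B.realised (B.shift x ω)).Finite
    rw [e]
    exact Set.Finite.preimage (fun _ _ _ _ h => List.append_cancel_right h) h
  · rintro ⟨h1, h2⟩
    refine (h1.union (M.finite_toSet.biUnion fun x hx => (h2 x hx).image fun z => z ++ x)).subset
      fun y hy => ?_
    by_cases h : y ∈ progeny M
    · obtain ⟨x, hx, z, rfl⟩ := h
      exact Or.inr (mem_biUnion hx ⟨z, (B.mem_realised_shift (hM hx) z).2 hy, rfl⟩)
    · exact Or.inl ⟨hy, h⟩

theorem measurableSet_finite_realised_diff {m : MeasurableSpace (PopulationSpace S Ωl)}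
    {P : Set Individual}
    (h : ∀ x ∉ P, MeasurableSet[m] {ω : PopulationSpace S Ωl | x ∈ B.realised ω}) :
    MeasurableSet[m] {ω : PopulationSpace S Ωl | (B.realised ω \ P).Finite} := by
  have e : {ω : PopulationSpace S Ωl | (B.realised ω \ P).Finite} =
      ⋃ F : Finset Individual, ⋂ x ∈ {x | x ∉ P ∧ x ∉ F}, {ω | x ∈ B.realised ω}ᶜ := by
    ext ω
    simp only [mem_ofPred_eq, mem_iUnion, mem_iInter, mem_compl_iff]
    constructor
    · intro h
      exact ⟨h.toFinset, fun x hx hR => hx.2 (h.mem_toFinset.2 ⟨hR, hx.1⟩)⟩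
    · rintro ⟨F, hF⟩
      refine F.finite_toSet.subset fun x hx => ?_
      by_contra hn
      exact hF x ⟨hx.2, hn⟩ hx.1
  rw [e]
  exact @MeasurableSet.iUnion _ _ m _ _ fun F =>
    @MeasurableSet.biInter _ _ m _ _ (to_countable _) fun x hx =>
      @MeasurableSet.compl _ _ m (h x hx.1)

theorem measurableSet_finite_realised_diff_progeny (M : Set Individual) :
    MeasurableSet[livesSigma S Ωl (progeny M)ᶜ]
      {ω : PopulationSpace S Ωl | (B.realised ω \ progeny M).Finite} := by
  refine B.measurableSet_finite_realised_diff fun x hx =>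
    B.measurableSet_mem_realised_livesSigma ?_
  rintro k y hy ⟨z, hz, hzy⟩
  exact hx ⟨z, hz, hzy.trans ((List.suffix_cons k y).trans hy)⟩

theorem lintegral_mul_indicator_shift (s : S) (x : Individual) {f : PopulationSpace S Ωl → ℝ≥0∞}
    (hf : Measurable[livesSigma S Ωl (progeny {x})ᶜ] f) {A : Set (PopulationSpace S Ωl)}
    (hA : MeasurableSet A) :
    ∫⁻ ω, f ω * A.indicator 1 (B.shift x ω) ∂B.law s =
      ∫⁻ ω, f ω * B.law (B.typeOf x ω) A ∂B.law s := by
  have h := setLIntegral_inter_eq (livesSigma_le _) (μ := B.law s)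
    ((B.law.measurable_coe hA).comp (B.measurable_typeOf x))
    (fun A' hA' => B.law_inter_shift s x hA' hA) hf (@MeasurableSet.univ _ (livesSigma S Ωl _))
  rw [univ_inter, setLIntegral_univ, ← lintegral_indicator (B.measurable_shift x hA)] at h
  simp only [mul_comm (f _)]
  refine Eq.trans (lintegral_congr fun ω => ?_) h
  by_cases hω : B.shift x ω ∈ A
  · simp [hω]
  · simp [hω]

/-- The branching property at a finite line. -/
theorem lintegral_mul_prod_indicator_shift (s : S) (M : Finset Individual)
    (hM : IsLine (M : Set Individual)) {f : PopulationSpace S Ωl → ℝ≥0∞}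
    (hf : Measurable[livesSigma S Ωl (progeny M)ᶜ] f)
    {A : Individual → Set (PopulationSpace S Ωl)} (hA : ∀ x ∈ M, MeasurableSet (A x)) :
    ∫⁻ ω, f ω * ∏ x ∈ M, (A x).indicator 1 (B.shift x ω) ∂B.law s =
      ∫⁻ ω, f ω * ∏ x ∈ M, B.law (B.typeOf x ω) (A x) ∂B.law s := by
  induction M using Finset.induction_on generalizing f with
  | empty => rfl
  | insert a M ha ih =>
    have haM : a ∈ ((insert a M : Finset Individual) : Set Individual) := by simp
    have hsub : (M : Set Individual) ⊆ (insert a M : Finset Individual) := by simp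
    have hAa := hA a (Finset.mem_insert_self a M)
    -- No other member of the line is comparable with `a`, so the factors of those members do not
    -- involve the progeny of `a` and can be absorbed into `f` when the branching property is
    -- applied at `a`.
    have hf' : Measurable[livesSigma S Ωl (progeny {a})ᶜ]
        fun ω => f ω * ∏ x ∈ M, (A x).indicator (1 : PopulationSpace S Ωl → ℝ≥0∞) (B.shift x ω) := by
      refine Measurable.mul (hf.mono (livesSigma_mono (compl_subset_compl.2
        (progeny_mono (singleton_subset_iff.2 haM)))) le_rfl)
        (Finset.measurable_fun_prod _ fun x hx => ?_)
      have hxa : ¬(x <:+ a ∨ a <:+ x) :=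
        hM x (hsub hx) a haM fun h => ha (h ▸ hx)
      have hsh := B.measurable_shift_livesSigma (V := (progeny {a})ᶜ) (W := univ) (x := x) ?_
        fun z _ => append_notMem_progeny_singleton hxa z
      · rw [livesSigma_univ] at hsh
        exact (measurable_one.indicator (hA x (Finset.mem_insert_of_mem hx))).comp hsh
      · intro k y hy hya
        exact mother_notMem_progeny hM (hsub hx) k y hy
          (progeny_mono (singleton_subset_iff.2 haM) hya)
    -- Once the factor of `a` has been averaged it depends on her type only, hence on a life off the
    -- progeny of the line, and joins `f` for the induction hypothesis.
    have hf'' : Measurable[livesSigma S Ωl (progeny M)ᶜ]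
        fun ω => f ω * B.law (B.typeOf a ω) (A a) := by
      refine Measurable.mono ?_ (livesSigma_mono (compl_subset_compl.2 (progeny_mono hsub))) le_rfl
      exact hf.mul ((B.law.measurable_coe hAa).comp (B.measurable_typeOf_preLine hM haM))
    calc _ = ∫⁻ ω, (f ω * ∏ x ∈ M, (A x).indicator 1 (B.shift x ω)) *
          (A a).indicator 1 (B.shift a ω) ∂B.law s := by
          refine lintegral_congr fun ω => ?_
          rw [Finset.prod_insert ha]
          ring
      _ = ∫⁻ ω, (f ω * ∏ x ∈ M, (A x).indicator 1 (B.shift x ω)) *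
          B.law (B.typeOf a ω) (A a) ∂B.law s := B.lintegral_mul_indicator_shift s a hf' hAa
      _ = ∫⁻ ω, (f ω * B.law (B.typeOf a ω) (A a)) *
          ∏ x ∈ M, (A x).indicator 1 (B.shift x ω) ∂B.law s := by
          refine lintegral_congr fun ω => ?_
          ring
      _ = ∫⁻ ω, (f ω * B.law (B.typeOf a ω) (A a)) *
          ∏ x ∈ M, B.law (B.typeOf x ω) (A x) ∂B.law s :=
          ih (hM.mono hsub) hf'' fun x hx => hA x (Finset.mem_insert_of_mem hx)
      _ = _ := by
          refine lintegral_congr fun ω => ?_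
          rw [Finset.prod_insert ha]
          ring

/-- The branching property at a finite line of realised individuals, on the event of extinction. -/
theorem setLIntegral_extinction_mul_prod_indicator_shift (s : S) (M : Finset Individual)
    (hM : IsLine (M : Set Individual)) {f : PopulationSpace S Ωl → ℝ≥0∞}
    (hf : Measurable[livesSigma S Ωl (progeny M)ᶜ] f)
    (hfM : ∀ ω, f ω ≠ 0 → ↑M ⊆ B.realised ω)
    {A : Individual → Set (PopulationSpace S Ωl)} (hA : ∀ x ∈ M, MeasurableSet (A x)) :
    ∫⁻ ω in B.extinction, f ω * ∏ x ∈ M, (A x).indicator 1 (B.shift x ω) ∂B.law s =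
      ∫⁻ ω, {ω | (B.realised ω \ progeny M).Finite}.indicator f ω *
        ∏ x ∈ M, B.law (B.typeOf x ω) (A x ∩ B.extinction) ∂B.law s := by
  rw [← B.lintegral_mul_prod_indicator_shift s M hM
    (hf.indicator (B.measurableSet_finite_realised_diff_progeny M))
    fun x hx => (hA x hx).inter B.measurableSet_extinction,
    ← lintegral_indicator B.measurableSet_extinction]
  refine lintegral_congr fun ω => ?_
  by_cases h0 : f ω = 0
  · classical simp [h0, indicator_apply]
  have hiff := B.mem_extinction_iff (hfM ω h0)
  simp only [inter_indicator_one, Pi.mul_apply, Finset.prod_mul_distrib]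
  by_cases hE : ω ∈ B.extinction
  · obtain ⟨h1, h2⟩ := hiff.1 hE
    rw [indicator_of_mem hE, indicator_of_mem (a := ω) h1,
      Finset.prod_congr rfl fun x hx => indicator_of_mem (h2 x hx) _]
    simp
  · rw [indicator_of_notMem hE]
    by_cases h1 : ω ∈ {ω | (B.realised ω \ progeny M).Finite}
    · obtain ⟨x, hx, hxE⟩ : ∃ x ∈ M, B.shift x ω ∉ B.extinction := by
        by_contra! h
        exact hE (hiff.2 ⟨h1, h⟩)
      rw [Finset.prod_eq_zero (f := fun x => B.extinction.indicator 1 (B.shift x ω)) hx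
        (indicator_of_notMem hxE _)]
      simp
    · rw [indicator_of_notMem h1, zero_mul]

theorem lintegral_condLaw (s : S) (f : PopulationSpace S Ωl → ℝ≥0∞) :
    ∫⁻ ω, f ω ∂B.condLaw s =
      (B.extinctionProb s)⁻¹ * ∫⁻ ω in B.extinction, f ω ∂B.law s := by
  change ∫⁻ ω, f ω ∂((B.law s B.extinction)⁻¹ • (B.law s).restrict B.extinction) = _
  rw [lintegral_smul_measure]
  rfl

theorem condLaw_mul_extinctionProb (s : S) (A : Set (PopulationSpace S Ωl)) :
    B.condLaw s A * B.extinctionProb s = B.law s (A ∩ B.extinction) := by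
  rw [inter_comm]
  exact cond_mul_eq_inter B.measurableSet_extinction A (B.law s)

/-- The branching property of the conditioned law at a finite line of realised individuals. -/
theorem lintegral_condLaw_mul_prod_indicator_shift (s : S)
    (M : Finset Individual) (hM : IsLine (M : Set Individual)) {f : PopulationSpace S Ωl → ℝ≥0∞}
    (hf : Measurable[livesSigma S Ωl (progeny M)ᶜ] f)
    (hfM : ∀ ω, f ω ≠ 0 → ↑M ⊆ B.realised ω)
    {A : Individual → Set (PopulationSpace S Ωl)} (hA : ∀ x ∈ M, MeasurableSet (A x)) :
    ∫⁻ ω, f ω * ∏ x ∈ M, (A x).indicator 1 (B.shift x ω) ∂B.condLaw s =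
      ∫⁻ ω, f ω * ∏ x ∈ M, B.condLaw (B.typeOf x ω) (A x) ∂B.condLaw s := by
  have hf' : Measurable[livesSigma S Ωl (progeny M)ᶜ]
      fun ω => f ω * ∏ x ∈ M, B.condLaw (B.typeOf x ω) (A x) :=
    hf.mul (Finset.measurable_fun_prod _ fun x hx =>
      (B.condLaw.measurable_coe (hA x hx)).comp (B.measurable_typeOf_preLine hM hx))
  -- With trivial events the extinction identity gives `∏ q_{σ_x}`; multiplied by the factors
  -- `ℙ̃_{σ_x}(A_x)` already contained in the integrand, this is `∏ ℙ_{σ_x}(A_x ∩ E)`, as on the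
  -- other side.
  have h := B.setLIntegral_extinction_mul_prod_indicator_shift s M hM hf'
    (fun ω hω => hfM ω (left_ne_zero_of_mul hω)) (A := fun _ => univ) fun _ _ => MeasurableSet.univ
  simp only [indicator_univ, Pi.one_apply, Finset.prod_const_one, mul_one, univ_inter] at h
  rw [lintegral_condLaw, lintegral_condLaw, h,
    B.setLIntegral_extinction_mul_prod_indicator_shift s M hM hf hfM hA]
  classical
  congr 1
  refine lintegral_congr fun ω => ?_
  simp only [indicator_apply]
  split_ifs
  · rw [mul_assoc, ← Finset.prod_mul_distrib]
    congr 1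
    exact Finset.prod_congr rfl fun x _ => (B.condLaw_mul_extinctionProb _ _).symm
  · simp

end BranchingProcess

/-! ### The conditioned process on the events of realised individuals -/

namespace BranchingProcess

variable {S Ωl : Type*} [MeasurableSpace S] [MeasurableSpace Ωl] (B : BranchingProcess S Ωl)

theorem isMarkovKernel_condLaw (hq : ∀ s, 0 < B.extinctionProb s) : IsMarkovKernel B.condLaw :=
  ⟨fun s => cond_isProbabilityMeasure (hq s).ne'⟩

theorem condLaw_absolutelyContinuous (s : S) : B.condLaw s ≪ B.law s :=
  cond_absolutelyContinuous

theorem condLaw_extinction (hq : ∀ s, 0 < B.extinctionProb s) (s : S) :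
    B.condLaw s B.extinction = 1 :=
  cond_apply_self (hq s).ne' (measure_ne_top _ _)

theorem law_preimage_fst (s : S) {D : Set S} (hD : MeasurableSet D) :
    B.law s (Prod.fst ⁻¹' D) = D.indicator 1 s := by
  rw [← Measure.map_apply measurable_fst hD, law_map_fst, Measure.dirac_apply' _ hD]

theorem condLaw_preimage_fst (hq : ∀ s, 0 < B.extinctionProb s) (s : S) {D : Set S}
    (hD : MeasurableSet D) : B.condLaw s (Prod.fst ⁻¹' D) = D.indicator 1 s := by
  have := B.isMarkovKernel_condLaw hq
  by_cases hs : s ∈ D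
  · rw [indicator_of_mem hs, Pi.one_apply, ← prob_compl_eq_zero_iff (measurable_fst hD)]
    refine B.condLaw_absolutelyContinuous s ?_
    rw [← preimage_compl, B.law_preimage_fst s hD.compl, indicator_of_notMem (not_not.2 hs)]
  · rw [indicator_of_notMem hs]
    refine B.condLaw_absolutelyContinuous s ?_
    rw [B.law_preimage_fst s hD, indicator_of_notMem hs]

theorem typeOf_conditioned (hq : ∀ s, 0 < B.extinctionProb s) (x : Individual) :
    (B.conditioned hq).typeOf x = B.typeOf x := by
  cases x <;> rfl

theorem birthTime_conditioned (hq : ∀ s, 0 < B.extinctionProb s) (x : Individual)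
    (ω : PopulationSpace S Ωl) : (B.conditioned hq).birthTime x ω = B.birthTime x ω := by
  induction x with
  | nil => rfl
  | cons k x ih =>
    change (B.conditioned hq).birthTime x ω + B.τ k (ω.2 x) = B.birthTime x ω + B.τ k (ω.2 x)
    rw [ih]

theorem realised_conditioned (hq : ∀ s, 0 < B.extinctionProb s) (ω : PopulationSpace S Ωl) :
    (B.conditioned hq).realised ω = B.realised ω := by
  simp only [realised, birthTime_conditioned]

theorem conditioned_life_apply (hq : ∀ s, 0 < B.extinctionProb s) (s : S) {C : Set Ωl}
    (hC : MeasurableSet C) :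
    (B.conditioned hq).life s C = B.condLaw s {ω | ω.2 [] ∈ C} :=
  Kernel.map_apply' _ ((measurable_pi_apply _).comp measurable_snd) _ hC

/-- Under the conditioned law, given the lives of all individuals that do not stem from her, a
realised individual lives according to the conditioned life kernel at her own type. -/
theorem condLaw_inter_life (hq : ∀ s, 0 < B.extinctionProb s) (s : S) (x : Individual)
    {A : Set (PopulationSpace S Ωl)} (hA : MeasurableSet[livesSigma S Ωl (progeny {x})ᶜ] A)
    (hAx : ∀ ω ∈ A, x ∈ B.realised ω) {C : Set Ωl} (hC : MeasurableSet C) :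
    B.condLaw s (A ∩ {ω | ω.2 x ∈ C}) =
      ∫⁻ ω in A, (B.conditioned hq).life (B.typeOf x ω) C ∂B.condLaw s := by
  classical
  have hA0 : MeasurableSet A := livesSigma_le _ _ hA
  have hx : IsLine ({x} : Set Individual) := by
    rintro y rfl z rfl h
    exact absurd rfl h
  have hf : Measurable[livesSigma S Ωl (progeny {x})ᶜ] (A.indicator (1 : PopulationSpace S Ωl → ℝ≥0∞)) :=
    Measurable.indicator (@measurable_const _ _ _ (livesSigma S Ωl (progeny {x})ᶜ) 1) hA
  have h := B.lintegral_condLaw_mul_prod_indicator_shift s {x} (by simpa using hx)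
    (f := A.indicator 1) (by rw [Finset.coe_singleton]; exact hf)
    (fun ω hω => by simpa using hAx ω (mem_of_indicator_ne_zero hω))
    (A := fun _ => {ω | ω.2 [] ∈ C}) fun _ _ => measurableSet_life_mem _ hC
  simp only [Finset.prod_singleton, ← B.conditioned_life_apply hq _ hC] at h
  rw [← lintegral_indicator hA0]
  rw [← lintegral_indicator_one (hA0.inter (measurableSet_life_mem x hC))]
  refine Eq.trans (lintegral_congr fun ω => ?_) (h.trans (lintegral_congr fun ω => ?_))
  · rw [inter_indicator_one]
    rfl
  · simp only [indicator_apply]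
    split_ifs <;> simp

/-- The σ-algebra generated by the type of the ancestor and the lives of the realised individuals
with numbers less than `n`. -/
@[reducible] def realisedSigmaLt (n : ℕ) : MeasurableSpace (PopulationSpace S Ωl) :=
  MeasurableSpace.comap Prod.fst inferInstance ⊔
    MeasurableSpace.generateFrom
      {A | ∃ (x : Individual) (C : Set Ωl), Encodable.encode x < n ∧ MeasurableSet C ∧
        A = {ω | x ∈ B.realised ω ∧ ω.2 x ∈ C}}

theorem measurable_fst_realisedSigmaLt (n : ℕ) :
    Measurable[B.realisedSigmaLt n] (fun ω : PopulationSpace S Ωl => ω.1) :=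
  Measurable.mono (comap_measurable _) le_sup_left le_rfl

theorem measurableSet_realisedSigmaLt {n : ℕ} {x : Individual} (hx : Encodable.encode x < n)
    {C : Set Ωl} (hC : MeasurableSet C) :
    MeasurableSet[B.realisedSigmaLt n] {ω | x ∈ B.realised ω ∧ ω.2 x ∈ C} :=
  (le_sup_right : _ ≤ B.realisedSigmaLt n) _
    (MeasurableSpace.measurableSet_generateFrom ⟨x, C, hx, hC, rfl⟩)

theorem realisedSigmaLt_le_of {n : ℕ} {m : MeasurableSpace (PopulationSpace S Ωl)}
    (h1 : Measurable[m] (fun ω : PopulationSpace S Ωl => ω.1))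
    (h2 : ∀ x C, Encodable.encode x < n → MeasurableSet C →
      MeasurableSet[m] {ω | x ∈ B.realised ω ∧ ω.2 x ∈ C}) : B.realisedSigmaLt n ≤ m := by
  refine sup_le h1.comap_le (MeasurableSpace.generateFrom_le ?_)
  rintro _ ⟨x, C, hx, hC, rfl⟩
  exact h2 x C hx hC

theorem measurableSet_mem_realised_lt (x : Individual) :
    MeasurableSet[livesSigma S Ωl {y | Encodable.encode y < Encodable.encode x}]
      {ω : PopulationSpace S Ωl | x ∈ B.realised ω} :=
  B.measurableSet_mem_realised_livesSigma fun k y hy =>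
    (encode_mother_lt k y).trans_le (encode_le_of_suffix hy)

theorem realisedSigmaLt_le_livesSigma (n : ℕ) :
    B.realisedSigmaLt n ≤ livesSigma S Ωl {y | Encodable.encode y < n} := by
  refine B.realisedSigmaLt_le_of (measurable_fst_livesSigma _) fun x C hx hC => ?_
  exact (livesSigma_mono (fun y hy => lt_trans (b := Encodable.encode x) hy hx) _
    (B.measurableSet_mem_realised_lt x)).inter
    (measurable_life_livesSigma (V := {y | Encodable.encode y < n}) hx hC)

/-- Both the birth of `x` and her type are read off the life of her realised mother, whose number is
smaller; this is why `≤ n` is enough. The type is observable only where `x` is realised, hence the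
joint event. -/
theorem measurableSet_realised_typeOf {n : ℕ} {x : Individual} (hx : Encodable.encode x ≤ n)
    {D : Set S} (hD : MeasurableSet D) :
    MeasurableSet[B.realisedSigmaLt n] {ω | x ∈ B.realised ω ∧ B.typeOf x ω ∈ D} := by
  cases x with
  | nil =>
    convert! B.measurable_fst_realisedSigmaLt n hD using 1
    ext ω
    simp [realised, birthTime, typeOf]
  | cons k y =>
    convert! B.measurableSet_realisedSigmaLt ((encode_mother_lt k y).trans_le hx)
      ((B.measurable_τ k (measurableSet_Iio (a := ∞))).inter (B.measurable_σ k hD)) using 1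
    ext ω
    simp only [realised, mem_ofPred_eq, birthTime, ENNReal.add_lt_top, typeOf, mem_inter_iff,
      mem_preimage, mem_Iio, and_assoc]

theorem measurable_indicator_realised_typeOf {n : ℕ} {x : Individual}
    (hx : Encodable.encode x ≤ n) {g : S → ℝ≥0∞} (hg : Measurable g) :
    Measurable[B.realisedSigmaLt n]
      ({ω | x ∈ B.realised ω}.indicator fun ω => g (B.typeOf x ω)) := by
  intro T hT
  have hR : MeasurableSet[B.realisedSigmaLt n] {ω : PopulationSpace S Ωl | x ∈ B.realised ω} := by
    simpa using B.measurableSet_realised_typeOf hx MeasurableSet.univ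
  rw [indicator_preimage, Set.ite]
  refine MeasurableSet.union ?_ (MeasurableSet.diff ?_ hR)
  · rw [inter_comm]
    exact B.measurableSet_realised_typeOf hx (hg hT)
  · exact @measurable_const _ _ _ (B.realisedSigmaLt n) 0 _ hT

/-- On the events pertaining only to realised individuals, the conditioned law is the law of the
branching process with the conditioned life kernel. -/
theorem condLaw_eq_law_conditioned (hq : ∀ s, 0 < B.extinctionProb s) (s : S)
    {A : Set (PopulationSpace S Ωl)} (hA : MeasurableSet[B.realisedSigma] A) :
    B.condLaw s A = (B.conditioned hq).law s A := by
  have := B.isMarkovKernel_condLaw hq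
  let z : ℕ → Individual := fun n => Denumerable.ofNat Individual n
  have hz : ∀ n, Encodable.encode (z n) = n := fun n => Denumerable.encode_ofNat _
  have hmeas : ∀ x C, MeasurableSet C →
      MeasurableSet {ω : PopulationSpace S Ωl | x ∈ B.realised ω ∧ ω.2 x ∈ C} := fun x C hC =>
    (B.measurableSet_mem_realised x).inter (measurableSet_life_mem x hC)
  refine measure_eq_on_iSup (H := B.realisedSigmaLt)
    (G := fun n => {E | ∃ C, MeasurableSet C ∧ E = {ω | z n ∈ B.realised ω ∧ ω.2 (z n) ∈ C}})
    (fun n => (B.realisedSigmaLt_le_livesSigma n).trans (livesSigma_le _)) ?_ ?_ ?_ ?_ ?_ ?_ ?_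
  · intro m n hmn
    exact B.realisedSigmaLt_le_of (B.measurable_fst_realisedSigmaLt n)
      fun x C hx hC => B.measurableSet_realisedSigmaLt (hx.trans_le hmn) hC
  · intro E hE
    have hle : B.realisedSigmaLt 0 ≤ MeasurableSpace.comap Prod.fst inferInstance :=
      B.realisedSigmaLt_le_of (comap_measurable _) fun x C hx => absurd hx (Nat.not_lt_zero _)
    obtain ⟨D, hD, rfl⟩ := hle _ hE
    rw [B.condLaw_preimage_fst hq s hD, law_preimage_fst _ s hD]
  · rintro n _ ⟨C, hC, rfl⟩ _ ⟨C', hC', rfl⟩ -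
    refine ⟨C ∩ C', hC.inter hC', ?_⟩
    ext ω
    simp only [mem_inter_iff, mem_ofPred_eq]
    tauto
  · rintro n _ ⟨C, hC, rfl⟩
    exact hmeas _ C hC
  · intro n
    refine B.realisedSigmaLt_le_of
      ((B.measurable_fst_realisedSigmaLt n).mono le_sup_left le_rfl) fun x C hx hC => ?_
    by_cases h : Encodable.encode x < n
    · exact (le_sup_left : B.realisedSigmaLt n ≤ _) _ (B.measurableSet_realisedSigmaLt h hC)
    · have hxz : x = z n := by
        have h3 : Encodable.encode x = n := by omega
        simp only [z]
        rw [← h3, Denumerable.ofNat_encode]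
      subst hxz
      exact (le_sup_right : _ ≤ B.realisedSigmaLt n ⊔ _) _
        (MeasurableSpace.measurableSet_generateFrom ⟨C, hC, rfl⟩)
  · rintro n _ ⟨C, hC, rfl⟩
    have hR := B.measurableSet_mem_realised (z n)
    -- The common density vanishes where `z n` is not realised: her life is then not recorded, and
    -- the two measures need not agree about it.
    refine ⟨{ω | z n ∈ B.realised ω}.indicator
        fun ω => (B.conditioned hq).life (B.typeOf (z n) ω) C,
      B.measurable_indicator_realised_typeOf (hz n).le
        ((B.conditioned hq).life.measurable_coe hC), fun A hA => ?_⟩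
    have hA' := B.realisedSigmaLt_le_livesSigma n _ hA
    have hAR : MeasurableSet[livesSigma S Ωl {y | Encodable.encode y < Encodable.encode (z n)}]
        (A ∩ {ω | z n ∈ B.realised ω}) := by
      refine MeasurableSet.inter ?_ (B.measurableSet_mem_realised_lt (z n))
      rw [hz]
      exact hA'
    have e : A ∩ {ω | z n ∈ B.realised ω ∧ ω.2 (z n) ∈ C} =
        A ∩ {ω | z n ∈ B.realised ω} ∩ {ω | ω.2 (z n) ∈ C} := by
      rw [inter_assoc]
      rfl
    rw [e, setLIntegral_indicator hR, setLIntegral_indicator hR,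
      inter_comm {ω | z n ∈ B.realised ω} A]
    constructor
    · refine B.condLaw_inter_life hq s (z n) (livesSigma_mono ?_ _ hAR) (fun ω hω => hω.2) hC
      rintro y hy ⟨_, rfl, h⟩
      exact absurd hy (not_lt.2 (encode_le_of_suffix h))
    · rw [(B.conditioned hq).law_inter_life_of_lt s (z n) hAR hC, typeOf_conditioned]
  · refine (sup_le ?_ (MeasurableSpace.generateFrom_le ?_) :
      B.realisedSigma ≤ ⨆ n, B.realisedSigmaLt n) _ hA
    · exact (B.measurable_fst_realisedSigmaLt 0).comap_le.trans (le_iSup B.realisedSigmaLt 0)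
    · rintro _ ⟨x, C, hC, rfl⟩
      exact le_iSup B.realisedSigmaLt (Encodable.encode x + 1) _
        (B.measurableSet_realisedSigmaLt (Nat.lt_succ_self _) hC)

theorem measurableSet_extinction_realisedSigma : MeasurableSet[B.realisedSigma] B.extinction := by
  have h := B.measurableSet_finite_realised_diff (m := B.realisedSigma) (P := ∅) fun x _ => ?_
  · simp only [sdiff_empty] at h
    exact h
  refine (le_sup_right : _ ≤ B.realisedSigma) _
    (MeasurableSpace.measurableSet_generateFrom ⟨x, univ, MeasurableSet.univ, ?_⟩)
  simp

/-- Extinction concerns realised individuals only, so the agreement of the two laws carries over the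
trivial identity `ℙ̃_s(E) = 1`. -/
theorem extinctionProb_conditioned (hq : ∀ s, 0 < B.extinctionProb s) (s : S) :
    (B.conditioned hq).extinctionProb s = 1 := by
  have e : (B.conditioned hq).extinction = B.extinction := by
    simp only [extinction, realised_conditioned]
  rw [extinctionProb, e,
    ← B.condLaw_eq_law_conditioned hq s B.measurableSet_extinction_realisedSigma,
    B.condLaw_extinction hq]

end BranchingProcess

/-! ### The realised part of a line: branching property and density -/

theorem tprod_subtype_of_eq_coe {α β : Type*} [CommMonoid α] [TopologicalSpace α] {T : Set β}
    {M : Finset β} (h : T = M) (f : β → α) : ∏' x : T, f x = ∏ x ∈ M, f x := by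
  subst h
  exact Finset.tprod_subtype M f

namespace BranchingProcess

variable {S Ωl : Type*} [MeasurableSpace S] [MeasurableSpace Ωl] (B : BranchingProcess S Ωl)

/-- Whether a member of `L` is realised depends on the lives of her proper ancestors, none of whom
stems from `L`. -/
theorem measurableSet_inter_realised_eq {L : Set Individual} (hL : IsLine L)
    (M : Finset Individual) :
    MeasurableSet[livesSigma S Ωl (progeny L)ᶜ]
      {ω : PopulationSpace S Ωl | L ∩ B.realised ω = M} := by
  have hx : ∀ x ∈ L, MeasurableSet[livesSigma S Ωl (progeny L)ᶜ]
      {ω : PopulationSpace S Ωl | x ∈ B.realised ω} := fun x hx =>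
    B.measurableSet_preLine_mem_realised hL hx x List.suffix_rfl
  by_cases hM : (M : Set Individual) ⊆ L
  · have e : {ω : PopulationSpace S Ωl | L ∩ B.realised ω = M} =
        (⋂ x ∈ (M : Set Individual), {ω | x ∈ B.realised ω}) ∩
          ⋂ x ∈ L \ M, {ω | x ∈ B.realised ω}ᶜ := by
      ext ω
      simp only [mem_ofPred_eq, mem_inter_iff, mem_iInter, mem_compl_iff]
      constructor
      · intro h
        refine ⟨fun x hx => ?_, fun x hx hR => ?_⟩
        · rw [← h] at hx
          exact hx.2
        · exact hx.2 (h ▸ ⟨hx.1, hR⟩)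
      · rintro ⟨h1, h2⟩
        refine Subset.antisymm (fun x hx => ?_) fun x hx => ⟨hM hx, h1 x hx⟩
        by_contra hn
        exact h2 x ⟨hx.1, hn⟩ hx.2
    rw [e]
    refine MeasurableSet.inter ?_ ?_
    · exact @MeasurableSet.biInter _ _ (livesSigma S Ωl (progeny L)ᶜ) _ _ (to_countable _)
        fun x h => hx x (hM h)
    · exact @MeasurableSet.biInter _ _ (livesSigma S Ωl (progeny L)ᶜ) _ _ (to_countable _)
        fun x h => @MeasurableSet.compl _ _ (livesSigma S Ωl (progeny L)ᶜ) (hx x h.1)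
  · convert! @MeasurableSet.empty _ (livesSigma S Ωl (progeny L)ᶜ) using 1
    refine eq_empty_of_forall_notMem fun ω hω => hM ?_
    rw [← (hω : L ∩ B.realised ω = M)]
    exact inter_subset_left

/-- If `N` lies in the progeny of `L`, then `ℱ_L ⊆ ℱ_N`; otherwise `L ∩ ℛ`, being part of `L`, can
never precede `N`. -/
theorem preLine_le_realisedPreLine {L : Set Individual} (hL : IsLine L) :
    livesSigma S Ωl (progeny L)ᶜ ≤ B.realisedPreLine hL := by
  intro A hA
  refine ⟨livesSigma_le _ _ hA, fun N hN => ?_⟩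
  by_cases h : N ⊆ progeny L
  · refine @MeasurableSet.inter _ (livesSigma S Ωl (progeny N)ᶜ) _ _
      (livesSigma_mono (compl_subset_compl.2 ?_) _ hA) ((B.isOptional_inter_realised hL).2 N hN)
    rintro y ⟨x, hx, hxy⟩
    obtain ⟨z, hz, hzx⟩ := h hx
    exact ⟨z, hz, hzx.trans hxy⟩
  · convert! @MeasurableSet.empty _ (livesSigma S Ωl (progeny N)ᶜ) using 1
    refine eq_empty_of_forall_notMem fun ω hω => h fun x hx => ?_
    exact progeny_mono inter_subset_left (hω.2 x hx)

/-- An event preceding `L ∩ R` is determined, where `L ∩ R = M`, by the lives of the individuals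
that do not stem from `M`. -/
theorem measurableSet_inter_inter_realised_eq {L : Set Individual} (hL : IsLine L)
    {C : Set (PopulationSpace S Ωl)} (hC : MeasurableSet[B.realisedPreLine hL] C)
    {M : Finset Individual} (hM : (M : Set Individual) ⊆ L) :
    MeasurableSet[livesSigma S Ωl (progeny M)ᶜ] (C ∩ {ω | L ∩ B.realised ω = M}) := by
  -- As part of `L`, the set `M` is itself a line and may be used as a test line; `L ∩ ℛ ≼ M` is
  -- automatic where `L ∩ ℛ = M`.
  have h1 := hC.2 M (hL.mono hM)
  have h2 := livesSigma_mono (compl_subset_compl.2 (progeny_mono hM)) _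
    (B.measurableSet_inter_realised_eq hL M)
  convert! @MeasurableSet.inter _ (livesSigma S Ωl (progeny M)ᶜ) _ _ h1 h2 using 1
  ext ω
  simp only [mem_inter_iff, mem_ofPred_eq]
  constructor
  · rintro ⟨hω, e⟩
    exact ⟨⟨hω, fun x hx => ⟨x, e ▸ hx, List.suffix_rfl⟩⟩, e⟩
  · rintro ⟨⟨hω, -⟩, e⟩
    exact ⟨hω, e⟩

theorem subset_realised_of_inter_eq {L : Set Individual} {M : Finset Individual}
    {ω : PopulationSpace S Ωl} (h : L ∩ B.realised ω = M) : ↑M ⊆ B.realised ω := by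
  rw [← h]
  exact inter_subset_right

/-- There are only countably many finite sets of individuals; this reduces the random line to
deterministic finite ones. -/
theorem setLIntegral_eq_tsum_inter_realised {L : Set Individual} (hL : IsLine L)
    {μ : Measure (PopulationSpace S Ωl)} (hμ : ∀ᵐ ω ∂μ, (L ∩ B.realised ω).Finite)
    {C : Set (PopulationSpace S Ωl)} (hC : MeasurableSet C) (f : PopulationSpace S Ωl → ℝ≥0∞) :
    ∫⁻ ω in C, f ω ∂μ =
      ∑' M : Finset Individual, ∫⁻ ω in C ∩ {ω | L ∩ B.realised ω = M}, f ω ∂μ := by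
  rw [← lintegral_iUnion]
  · refine setLIntegral_congr ?_
    filter_upwards [hμ] with ω hω
    refine propext ⟨fun h => ?_, fun h => ?_⟩
    · exact mem_iUnion.2 ⟨hω.toFinset, h, by simp⟩
    · obtain ⟨M, hM⟩ := mem_iUnion.1 h
      exact hM.1
  · exact fun M => hC.inter (livesSigma_le _ _ (B.measurableSet_inter_realised_eq hL M))
  · intro M N hMN
    refine disjoint_left.2 fun ω h1 h2 => hMN ?_
    exact Finset.coe_injective (h1.2.symm.trans h2.2)

/-- The product of `φ x (σ_x)` over `x ∈ L ∩ R`, and zero if `L ∩ R` is infinite. -/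
noncomputable def prodLine (L : Set Individual) (φ : Individual → S → ℝ≥0∞)
    (ω : PopulationSpace S Ωl) : ℝ≥0∞ :=
  ∑' M : Finset Individual, {ω | L ∩ B.realised ω = M}.indicator
    (fun ω => ∏ x ∈ M, φ x (B.typeOf x ω)) ω

theorem prodLine_of_eq {L : Set Individual} (φ : Individual → S → ℝ≥0∞)
    {ω : PopulationSpace S Ωl} {M : Finset Individual} (h : L ∩ B.realised ω = M) :
    B.prodLine L φ ω = ∏ x ∈ M, φ x (B.typeOf x ω) := by
  rw [prodLine, tsum_eq_single M]
  · exact indicator_of_mem (s := {ω | L ∩ B.realised ω = M}) h _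
  · intro N hN
    refine indicator_of_notMem (fun h' => hN ?_) _
    exact Finset.coe_injective ((h' : L ∩ B.realised ω = N).symm.trans h)

theorem measurable_prodLine {L : Set Individual} (hL : IsLine L) {φ : Individual → S → ℝ≥0∞}
    (hφ : ∀ x ∈ L, Measurable (φ x)) :
    Measurable[livesSigma S Ωl (progeny L)ᶜ] (B.prodLine L φ) := by
  refine @Measurable.tsum _ _ _ (livesSigma S Ωl (progeny L)ᶜ) _ _ _ _ _ _ _ _ _ _ _ _ fun M => ?_
  by_cases hM : (M : Set Individual) ⊆ L
  · refine Measurable.indicator ?_ (B.measurableSet_inter_realised_eq hL M)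
    exact Finset.measurable_fun_prod _ fun x hx =>
      (hφ x (hM hx)).comp (B.measurable_typeOf_preLine hL (hM hx))
  · have e : {ω : PopulationSpace S Ωl | L ∩ B.realised ω = M} = ∅ := by
      refine eq_empty_of_forall_notMem fun ω hω => hM ?_
      rw [← (hω : L ∩ B.realised ω = M)]
      exact inter_subset_left
    rw [e, indicator_empty]
    exact @measurable_const _ _ _ (_) 0

theorem setLIntegral_prodLine {L : Set Individual} (hL : IsLine L) (φ : Individual → S → ℝ≥0∞)
    {μ : Measure (PopulationSpace S Ωl)} (hμ : ∀ᵐ ω ∂μ, (L ∩ B.realised ω).Finite)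
    {C : Set (PopulationSpace S Ωl)} (hC : MeasurableSet C) :
    ∫⁻ ω in C, B.prodLine L φ ω ∂μ = ∑' M : Finset Individual,
      ∫⁻ ω, (C ∩ {ω | L ∩ B.realised ω = M}).indicator 1 ω *
        ∏ x ∈ M, φ x (B.typeOf x ω) ∂μ := by
  rw [B.setLIntegral_eq_tsum_inter_realised hL hμ hC]
  refine tsum_congr fun M => ?_
  rw [← lintegral_indicator
    (hC.inter (livesSigma_le _ _ (B.measurableSet_inter_realised_eq hL M)))]
  refine lintegral_congr fun ω => ?_
  by_cases h : ω ∈ C ∩ {ω | L ∩ B.realised ω = M}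
  · rw [indicator_of_mem h, indicator_of_mem h, B.prodLine_of_eq φ h.2, Pi.one_apply, one_mul]
  · rw [indicator_of_notMem h, indicator_of_notMem h, zero_mul]

theorem condLaw_inter_realised_finite (hq : ∀ s, 0 < B.extinctionProb s) (s : S)
    (L : Set Individual) : ∀ᵐ ω ∂B.condLaw s, (L ∩ B.realised ω).Finite := by
  have := B.isMarkovKernel_condLaw hq
  have h := (mem_ae_iff_prob_eq_one B.measurableSet_extinction).2 (B.condLaw_extinction hq s)
  filter_upwards [h] with ω hω
  exact Set.Finite.subset hω inter_subset_right

theorem measurable_indicator_inter_realised_eq {L : Set Individual} (hL : IsLine L)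
    {C : Set (PopulationSpace S Ωl)} (hC : MeasurableSet[B.realisedPreLine hL] C)
    {M : Finset Individual} (hM : (M : Set Individual) ⊆ L) :
    Measurable[livesSigma S Ωl (progeny M)ᶜ]
      ((C ∩ {ω | L ∩ B.realised ω = M}).indicator (1 : PopulationSpace S Ωl → ℝ≥0∞)) :=
  Measurable.indicator (@measurable_const _ _ _ (livesSigma S Ωl (progeny M)ᶜ) 1)
    (B.measurableSet_inter_inter_realised_eq hL hC hM)

theorem indicator_inter_realised_eq_of_not_subset {L : Set Individual}
    (C : Set (PopulationSpace S Ωl)) {M : Finset Individual} (hM : ¬(M : Set Individual) ⊆ L)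
    (ω : PopulationSpace S Ωl) :
    (C ∩ {ω | L ∩ B.realised ω = M}).indicator (1 : PopulationSpace S Ωl → ℝ≥0∞) ω = 0 := by
  refine indicator_of_notMem (fun h => hM ?_) _
  rw [← (h.2 : L ∩ B.realised ω = M)]
  exact inter_subset_left

/-- The branching property of the conditioned law at the realised part of a line. -/
theorem condLaw_inter_iInter_shift (hq : ∀ s, 0 < B.extinctionProb s) (s : S)
    {L : Set Individual} (hL : IsLine L) {A : Individual → Set (PopulationSpace S Ωl)}
    (hA : ∀ x ∈ L, MeasurableSet (A x)) {C : Set (PopulationSpace S Ωl)}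
    (hC : MeasurableSet[B.realisedPreLine hL] C) :
    B.condLaw s (C ∩ ⋂ x ∈ L, {ω | x ∈ B.realised ω → B.shift x ω ∈ A x}) =
      ∫⁻ ω in C, B.prodLine L (fun x r => B.condLaw r (A x)) ω ∂B.condLaw s := by
  have hfin := B.condLaw_inter_realised_finite hq s L
  have hC0 : MeasurableSet C := hC.1
  have hD : MeasurableSet (⋂ x ∈ L, {ω | x ∈ B.realised ω → B.shift x ω ∈ A x}) := by
    refine MeasurableSet.biInter (to_countable _) fun x hx => ?_
    simp only [imp_iff_not_or]
    exact (B.measurableSet_mem_realised x).compl.union (B.measurable_shift x (hA x hx))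
  rw [inter_comm, ← Measure.restrict_apply hD, ← lintegral_indicator_one hD,
    B.setLIntegral_eq_tsum_inter_realised hL hfin hC0, B.setLIntegral_prodLine hL _ hfin hC0]
  refine tsum_congr fun M => ?_
  rw [← lintegral_indicator
    (hC0.inter (livesSigma_le _ _ (B.measurableSet_inter_realised_eq hL M)))]
  by_cases hM : (M : Set Individual) ⊆ L
  · rw [← B.lintegral_condLaw_mul_prod_indicator_shift s M (hL.mono hM)
      (B.measurable_indicator_inter_realised_eq hL hC hM)
      (fun ω hω => B.subset_realised_of_inter_eq (mem_of_indicator_ne_zero hω).2)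
      fun x hx => hA x (hM hx)]
    refine lintegral_congr fun ω => ?_
    by_cases h : ω ∈ C ∩ {ω | L ∩ B.realised ω = M}
    · rw [indicator_of_mem h, indicator_of_mem h, Pi.one_apply, one_mul]
      have hmem : ∀ x, x ∈ M ↔ x ∈ L ∧ x ∈ B.realised ω := fun x => by
        rw [← Finset.mem_coe, ← (h.2 : L ∩ B.realised ω = M)]
        rfl
      by_cases hω : ω ∈ ⋂ x ∈ L, {ω | x ∈ B.realised ω → B.shift x ω ∈ A x}
      · rw [indicator_of_mem hω, Pi.one_apply]
        refine (Finset.prod_eq_one fun x hx => ?_).symm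
        have h1 := (hmem x).1 hx
        exact indicator_of_mem (mem_iInter₂.1 hω x h1.1 h1.2) _
      · rw [indicator_of_notMem hω]
        simp only [mem_iInter, not_forall] at hω
        obtain ⟨x, hxL, hx⟩ := hω
        rw [mem_ofPred_eq, Classical.not_imp] at hx
        exact (Finset.prod_eq_zero ((hmem x).2 ⟨hxL, hx.1⟩) (indicator_of_notMem hx.2 _)).symm
    · rw [indicator_of_notMem h, indicator_of_notMem h, zero_mul]
  · refine lintegral_congr fun ω => ?_
    rw [B.indicator_inter_realised_eq_of_not_subset C hM, zero_mul]
    refine indicator_of_notMem (fun h => hM ?_) _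
    rw [← (h.2 : L ∩ B.realised ω = M)]
    exact inter_subset_left

theorem condExp_condLaw_iInter_shift (hq : ∀ s, 0 < B.extinctionProb s) (s : S)
    {L : Set Individual} (hL : IsLine L) {A : Individual → Set (PopulationSpace S Ωl)}
    (hA : ∀ x ∈ L, MeasurableSet (A x)) :
    (B.condLaw s)⟦⋂ x ∈ L, {ω | x ∈ B.realised ω → B.shift x ω ∈ A x} |
        B.realisedPreLine hL⟧ =ᵐ[B.condLaw s]
      fun ω => ∏' x : ↥(L ∩ B.realised ω), (B.condLaw (B.typeOf x ω)).real (A x) := by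
  have := B.isMarkovKernel_condLaw hq
  have hfin := B.condLaw_inter_realised_finite hq s L
  set g := B.prodLine L (fun x r => B.condLaw r (A x)) with hg
  have hgm' : Measurable[B.realisedPreLine hL] g :=
    (B.measurable_prodLine hL fun x hx => B.condLaw.measurable_coe (hA x hx)).mono
      (B.preLine_le_realisedPreLine hL) le_rfl
  have hgm : Measurable g := hgm'.mono (B.realisedPreLine_le hL) le_rfl
  have hD : MeasurableSet (⋂ x ∈ L, {ω | x ∈ B.realised ω → B.shift x ω ∈ A x}) := by
    refine MeasurableSet.biInter (to_countable _) fun x hx => ?_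
    simp only [imp_iff_not_or]
    exact (B.measurableSet_mem_realised x).compl.union (B.measurable_shift x (hA x hx))
  have hkey := fun C hC => B.condLaw_inter_iInter_shift hq s hL hA (C := C) hC
  -- The total integral of `g` is a probability, by the set identity on the whole space.
  have hgint : ∫⁻ ω, g ω ∂B.condLaw s ≠ ∞ := by
    have h := hkey univ MeasurableSet.univ
    rw [setLIntegral_univ] at h
    rw [← h]
    exact measure_ne_top _ _
  have hae : (fun ω => ∏' x : ↥(L ∩ B.realised ω), (B.condLaw (B.typeOf x ω)).real (A x))
      =ᵐ[B.condLaw s] fun ω => (g ω).toReal := by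
    filter_upwards [hfin] with ω hω
    have e : L ∩ B.realised ω = hω.toFinset := by simp
    rw [tprod_subtype_of_eq_coe e fun x => (B.condLaw (B.typeOf x ω)).real (A x), hg,
      B.prodLine_of_eq _ e, ENNReal.toReal_prod]
    rfl
  refine Filter.EventuallyEq.trans (Filter.EventuallyEq.symm ?_) hae.symm
  have hgi : Integrable (fun ω => (g ω).toReal) (B.condLaw s) :=
    integrable_toReal_of_lintegral_ne_top hgm.aemeasurable hgint
  refine ae_eq_condExp_of_forall_setIntegral_eq (B.realisedPreLine_le hL)
    ((integrable_const 1).indicator hD) (fun _ _ _ => hgi.integrableOn) (fun C hC _ => ?_)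
    (Measurable.ennreal_toReal (mα := B.realisedPreLine hL) hgm').aestronglyMeasurable
  have hC0 : MeasurableSet C := hC.1
  rw [integral_toReal hgm.aemeasurable (ae_restrict_of_ae (ae_lt_top hgm hgint)), ← hkey C hC,
    setIntegral_indicator hD]
  simp [Measure.real]

/-- The density of the conditioned law on the events preceding the realised part of a line. -/
theorem condLaw_eq_setLIntegral_prodLine (s : S) (hq : ∀ s, 0 < B.extinctionProb s)
    {L : Set Individual} (hL : IsLine L)
    (hfin : ∀ᵐ ω ∂B.law s, (B.realised ω \ properProgeny L).Finite)
    {C : Set (PopulationSpace S Ωl)} (hC : MeasurableSet[B.realisedPreLine hL] C) :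
    B.condLaw s C = ∫⁻ ω in C, (B.extinctionProb s)⁻¹ *
      B.prodLine L (fun _ r => B.extinctionProb r) ω ∂B.law s := by
  have hC0 : MeasurableSet C := hC.1
  have hm : Measurable (B.prodLine L fun _ r => B.extinctionProb r) :=
    (B.measurable_prodLine hL fun _ _ => B.law.measurable_coe B.measurableSet_extinction).mono
      (livesSigma_le _) le_rfl
  have hfin' : ∀ᵐ ω ∂B.law s, (L ∩ B.realised ω).Finite := by
    filter_upwards [hfin] with ω hω
    refine hω.subset fun x hx => ⟨hx.2, ?_⟩
    rintro ⟨y, hy, hyx, hne⟩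
    exact hL y hy x hx.1 hne (Or.inl hyx)
  rw [lintegral_const_mul _ hm, ← setLIntegral_one C,
    B.setLIntegral_eq_tsum_inter_realised hL (B.condLaw_inter_realised_finite hq s L) hC0,
    B.setLIntegral_prodLine hL _ hfin' hC0, ← ENNReal.tsum_mul_left]
  refine tsum_congr fun M => ?_
  have hCM := hC0.inter (livesSigma_le _ _ (B.measurableSet_inter_realised_eq hL M))
  rw [setLIntegral_one, ← lintegral_indicator_one hCM, lintegral_condLaw]
  congr 1
  by_cases hM : (M : Set Individual) ⊆ L
  · have h := B.setLIntegral_extinction_mul_prod_indicator_shift s M (hL.mono hM)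
      (B.measurable_indicator_inter_realised_eq hL hC hM)
      (fun ω hω => B.subset_realised_of_inter_eq (mem_of_indicator_ne_zero hω).2)
      (A := fun _ => univ) fun _ _ => MeasurableSet.univ
    simp only [indicator_univ, Pi.one_apply, Finset.prod_const_one, mul_one, univ_inter] at h
    rw [h]
    refine lintegral_congr_ae ?_
    filter_upwards [hfin] with ω hω
    by_cases h : ω ∈ C ∩ {ω | L ∩ B.realised ω = M}
    -- A realised individual stemming from a member of `L` makes that member realised, hence an
    -- element of `M`. So those off the progeny of `M` are not proper descendants of `L`, and the
    -- finiteness condition makes the indicator one.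
    · have hG : ω ∈ {ω | (B.realised ω \ progeny M).Finite} := by
        refine hω.subset fun y hy => ⟨hy.1, ?_⟩
        rintro ⟨x, hx, hxy, -⟩
        refine hy.2 ⟨x, ?_, hxy⟩
        rw [← (h.2 : L ∩ B.realised ω = M)]
        exact ⟨hx, B.mem_realised_of_suffix hxy hy.1⟩
      rw [indicator_of_mem (s := {ω | (B.realised ω \ progeny M).Finite}) hG]
      rfl
    · classical
      rw [indicator_apply, indicator_of_notMem h]
      simp
  · simp only [B.indicator_inter_realised_eq_of_not_subset C hM, zero_mul, lintegral_zero]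

theorem rnDeriv_condLaw_trim (s : S) (hq : ∀ s, 0 < B.extinctionProb s)
    {L : Set Individual} (hL : IsLine L)
    (hfin : ∀ᵐ ω ∂B.law s, (B.realised ω \ properProgeny L).Finite) :
    (B.condLaw s).trim (B.realisedPreLine_le hL) ≪ (B.law s).trim (B.realisedPreLine_le hL) ∧
      ((B.condLaw s).trim (B.realisedPreLine_le hL)).rnDeriv
          ((B.law s).trim (B.realisedPreLine_le hL))
        =ᵐ[(B.law s).trim (B.realisedPreLine_le hL)]
      fun ω => (B.extinctionProb s)⁻¹ *
        ∏' x : ↥(L ∩ B.realised ω), B.extinctionProb (B.typeOf x ω) := by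
  have hle := B.realisedPreLine_le hL
  set m := B.realisedPreLine hL with hm_def
  set g : PopulationSpace S Ωl → ℝ≥0∞ := fun ω => (B.extinctionProb s)⁻¹ *
    B.prodLine L (fun _ r => B.extinctionProb r) ω with hg
  have hgm : Measurable[m] g := by
    refine Measurable.const_mul ?_ _
    exact (B.measurable_prodLine hL fun _ _ => B.law.measurable_coe B.measurableSet_extinction).mono
      (B.preLine_le_realisedPreLine hL) le_rfl
  have e : (B.condLaw s).trim hle = @Measure.withDensity _ m ((B.law s).trim hle) g := by
    refine @Measure.ext _ m _ _ fun C hC => ?_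
    rw [trim_measurableSet_eq hle hC, withDensity_apply _ hC, setLIntegral_trim hle hgm hC,
      B.condLaw_eq_setLIntegral_prodLine s hq hL hfin hC]
  rw [e]
  refine ⟨@withDensity_absolutelyContinuous _ m _ _, ?_⟩
  refine (@Measure.rnDeriv_withDensity _ m ((B.law s).trim hle) _ _ hgm).trans ?_
  -- The null set where `L ∩ ℛ` is infinite must belong to the small σ-algebra in order to be
  -- negligible for the trimmed measure.
  have hF : MeasurableSet[m] {ω : PopulationSpace S Ωl | (L ∩ B.realised ω).Finite} := by
    have e : {ω : PopulationSpace S Ωl | (L ∩ B.realised ω).Finite} =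
        ⋃ M : Finset Individual, {ω | L ∩ B.realised ω = M} := by
      ext ω
      simp only [mem_ofPred_eq, mem_iUnion]
      exact ⟨fun h => ⟨h.toFinset, by simp⟩, fun ⟨M, hM⟩ => hM ▸ M.finite_toSet⟩
    rw [e]
    exact @MeasurableSet.iUnion _ _ m _ _ fun M =>
      B.preLine_le_realisedPreLine hL _ (B.measurableSet_inter_realised_eq hL M)
  have hfin' : ∀ᵐ ω ∂(B.law s).trim hle, (L ∩ B.realised ω).Finite := by
    rw [ae_iff]
    refine (trim_measurableSet_eq hle (@MeasurableSet.compl _ _ m hF)).trans (ae_iff.1 ?_)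
    filter_upwards [hfin] with ω hω
    refine hω.subset fun x hx => ⟨hx.2, ?_⟩
    rintro ⟨y, hy, hyx, hne⟩
    exact hL y hy x hx.1 hne (Or.inl hyx)
  filter_upwards [hfin'] with ω hω
  have e : L ∩ B.realised ω = hω.toFinset := by simp
  rw [hg, tprod_subtype_of_eq_coe e fun x => B.extinctionProb (B.typeOf x ω)]
  simp only [B.prodLine_of_eq _ e]

/-! ### The finiteness condition -/

/-- König's lemma. -/
theorem finite_realised_diff_properProgeny {L : Set Individual}
    (hL : ∀ c, IsInfiniteDescent c → ∃ n, c n ∈ L) {ω : PopulationSpace S Ωl}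
    (hω : ∀ x, {k | B.τ k (ω.2 x) < ∞}.Finite) : (B.realised ω \ properProgeny L).Finite := by
  by_contra hinf
  set T := B.realised ω \ properProgeny L with hT
  -- `Q x` says that infinitely many members of `T` stem from `x`. It passes to some child: each
  -- such member other than `x` stems from a child that is born, and there are finitely many of
  -- these.
  let Q : Individual → Prop := fun x => (T ∩ {y | x <:+ y}).Infinite
  have hnext : ∀ x, Q x → ∃ k : ℕ, Q (k :: x) := by
    intro x hx
    by_contra! h
    refine hx (((finite_singleton x).union
      ((hω x).biUnion fun k _ => not_infinite.1 (h k))).subset ?_)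
    rintro y ⟨hyT, z, rfl⟩
    rcases List.eq_nil_or_concat z with rfl | ⟨z, k, rfl⟩
    · exact Or.inl rfl
    · have hs : k :: x <:+ z.concat k ++ x := ⟨z, by simp⟩
      have hk : B.birthTime x ω + B.τ k (ω.2 x) < ∞ := B.mem_realised_of_suffix hs hyT.1
      exact Or.inr (mem_biUnion (ENNReal.add_lt_top.1 hk).2 ⟨hyT, hs⟩)
  choose! next hnext using hnext
  let c : ℕ → Individual := fun n => Nat.rec [] (fun _ x => next x :: x) n
  have hc : ∀ n, Q (c n) := by
    intro n
    induction n with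
    | zero =>
      have e : T ∩ {y | [] <:+ y} = T := by
        ext y
        simp [List.nil_suffix]
      change (T ∩ {y | [] <:+ y}).Infinite
      rw [e]
      exact hinf
    | succ n ih => exact hnext (c n) ih
  -- Past its meeting point with `L`, the path has only proper descendants of `L` stemming from it,
  -- yet `Q` still provides a member of `T` there.
  obtain ⟨n, hn⟩ := hL c ⟨rfl, fun n => ⟨next (c n), rfl⟩⟩
  obtain ⟨y, hyT, hy⟩ := (hc (n + 1)).nonempty
  have hy' : next (c n) :: c n <:+ y := hy
  refine hyT.2 ⟨c n, hn, (List.suffix_cons _ _).trans hy', ?_⟩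
  intro h
  have hlen := hy'.length_le
  rw [← h, List.length_cons] at hlen
  omega

/-- Monotonicity of `τ` reduces finiteness to `τ k = ∞` for some `k`, a measurable condition on a
life. Averaging the life kernel over the type of each of the countably many individuals gives the
claim. -/
theorem ae_finite_children (h : ∀ r, ∀ᵐ w ∂B.life r, {k | B.τ k w < ∞}.Finite) (s : S) :
    ∀ᵐ ω ∂B.law s, ∀ x, {k | B.τ k (ω.2 x) < ∞}.Finite := by
  have hiff : ∀ w, {k | B.τ k w < ∞}.Finite ↔ ∃ k, B.τ k w = ∞ := by
    intro w
    constructor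
    · intro hw
      obtain ⟨k, hk⟩ := hw.infinite_compl.nonempty
      exact ⟨k, not_lt_top_iff.1 hk⟩
    · rintro ⟨k, hk⟩
      refine (finite_Iio k).subset fun j hj => ?_
      by_contra hn
      have h1 := B.monotone_τ w (not_lt.1 hn)
      simp only [hk, top_le_iff] at h1
      exact absurd h1 (ne_of_lt hj)
  have hC : MeasurableSet {w | ¬{k | B.τ k w < ∞}.Finite} := by
    simp only [hiff]
    refine MeasurableSet.compl ?_
    have e : {w | ∃ k, B.τ k w = ∞} = ⋃ k, B.τ k ⁻¹' {∞} := by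
      ext
      simp
    change MeasurableSet {w | ∃ k, B.τ k w = ∞}
    rw [e]
    exact MeasurableSet.iUnion fun k => B.measurable_τ k (measurableSet_singleton _)
  refine ae_all_iff.2 fun x => ?_
  have hx := B.law_inter_life s x (@MeasurableSet.univ _ (livesSigma S Ωl _)) hC
  rw [univ_inter] at hx
  refine ae_iff.2 (hx.trans ?_)
  simp only [fun r => ae_iff.1 (h r), lintegral_zero]

end BranchingProcess


theorem mainTheorem1 {S Ωl : Type*} [MeasurableSpace S] [MeasurableSpace Ωl]
    (B : BranchingProcess S Ωl) (hq : ∀ s, 0 < B.extinctionProb s) :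
    -- the conditioned process is the branching process with the conditioned life kernel
    (∀ s, ∀ A, MeasurableSet[B.realisedSigma] A →
      B.condLaw s A = (B.conditioned hq).law s A) ∧
    -- whose extinction probability is one
    (∀ s, (B.conditioned hq).extinctionProb s = 1) ∧
    -- the branching property of the conditioned law
    (∀ s, ∀ L, ∀ hL : IsCoveringLine L,
      ∀ A : Individual → Set (PopulationSpace S Ωl), (∀ x ∈ L, MeasurableSet (A x)) →
        (B.condLaw s)⟦⋂ x ∈ L, {ω | x ∈ B.realised ω → B.shift x ω ∈ A x} |
            B.realisedPreLine hL.1⟧ =ᵐ[B.condLaw s]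
          fun ω => ∏' x : ↥(L ∩ B.realised ω), (B.condLaw (B.typeOf x ω)).real (A x)) ∧
    -- the Radon-Nikodym derivative
    (∀ s, ∀ L, ∀ hL : IsCoveringLine L,
      (∀ᵐ ω ∂B.law s, (B.realised ω \ properProgeny L).Finite) →
        (B.condLaw s).trim (B.realisedPreLine_le hL.1) ≪
            (B.law s).trim (B.realisedPreLine_le hL.1) ∧
          ((B.condLaw s).trim (B.realisedPreLine_le hL.1)).rnDeriv
              ((B.law s).trim (B.realisedPreLine_le hL.1))
            =ᵐ[(B.law s).trim (B.realisedPreLine_le hL.1)]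
          fun ω => (B.extinctionProb s)⁻¹ *
            ∏' x : ↥(L ∩ B.realised ω), B.extinctionProb (B.typeOf x ω)) ∧
    -- a sufficient condition for the finiteness in the previous part
    ((∀ r, ∀ᵐ w ∂B.life r, {k | B.τ k w < ∞}.Finite) →
      ∀ L, IsLine L → (∀ c, IsInfiniteDescent c → ∃ n, c n ∈ L) →
        ∀ s, ∀ᵐ ω ∂B.law s, (B.realised ω \ properProgeny L).Finite) := by
  refine ⟨fun s A hA => B.condLaw_eq_law_conditioned hq s hA, B.extinctionProb_conditioned hq,
    fun s L hL A hA => B.condExp_condLaw_iInter_shift hq s hL.1 hA,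
    fun s L hL hfin => B.rnDeriv_condLaw_trim s hq hL.1 hfin, fun h L _ hd s => ?_⟩
  filter_upwards [B.ae_finite_children h s] with ω hω
  exact B.finite_realised_diff_properProgeny hd hω
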